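/- Let $k$ be an arbitrary field. For $f=(f_1,\dots,f_n)\in\operatorname{End}(\mathbb{A}^n_k)=k[x_1,\dots,x_n]^n$ put $\deg f=\max_i\deg f_i$, and for an automorphism $f$ let $\lambda(f)=\lim_{m\to\infty}\deg(f^m)^{1/m}$ be its dynamical degree, where $f^m$ is the $m$-th iterate. An automorphism of $\mathbb{A}^n_k$ is called affine-triangular if it is of the form $\alpha\circ\tau$ with $\alpha$ an affine automorphism (an automorphism of degree $1$) and $\tau=(\tau_1,\dots,\tau_n)$ a triangular endomorphism ($\tau_i\in k[x_1,\dots,x_i]$ for each $i$). For all integers $r,s,t\ge 1$, $$f=\bigl(y+x^rz^t,\; z,\; x+z^s(y+x^rz^t)\bigr)$$ is an automorphism of $\mathbb{A}^3_k$, the limit defining $\lambda(f)$ exists, $\lambda(f)$ is the largest real root of $x^2-(r+s+t)x+rs$, and $\lambda(f)>s+1$. Moreover, if $\lambda(f)$ is not an integer, then $\lambda(f)$ is not the dynamical degree of any affine-triangular automorphism of $\mathbb{A}^3_k$, and $f$ is not conjugate in $\operatorname{Aut}(\mathbb{A}^3_k)$ to any affine-triangular automorphism of $\mathbb{A}^3_k$.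 -/

import Mathlib

open Filter Topology MvPolynomial

/-- A polynomial endomorphism `(f₁, …, fₙ)` of affine `n`-space over `k`. -/
@[ext]
structure PolyEnd (k : Type*) [Field k] (n : ℕ) where
  coord : Fin n → MvPolynomial (Fin n) k

namespace PolyEnd

variable {k : Type*} [Field k] {n : ℕ}

/-- The monoid `End(𝔸ⁿ)`: the product is the composition of maps,
`(f * g)ᵢ = fᵢ(g₁, …, gₙ)`, and the unit is the identity `(x₁, …, xₙ)`.
Its units form the group `Aut(𝔸ⁿ)`. -/
noncomputable instance : Monoid (PolyEnd k n) where
  one := ⟨X⟩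
  mul f g := ⟨fun i => bind₁ g.coord (f.coord i)⟩
  mul_assoc f g h := by
    ext1
    funext i
    exact bind₁_bind₁ g.coord h.coord (f.coord i)
  one_mul f := by
    ext1
    funext i
    exact bind₁_X_right f.coord i
  mul_one f := by
    ext1
    funext i
    exact congrArg (fun φ => φ (f.coord i)) bind₁_X_left

/-- The degree of an endomorphism: the maximum of the degrees of its coordinates. -/
noncomputable def degree (f : PolyEnd k n) : ℕ :=
  Finset.univ.sup fun i => (f.coord i).totalDegree

/-- The sequence `m ↦ deg(f ^ m) ^ (1 / m)`, where `f ^ m` is the `m`-th iterate of `f`. -/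
noncomputable def degreeSeq (f : PolyEnd k n) (m : ℕ) : ℝ :=
  ((f ^ m).degree : ℝ) ^ (1 / (m : ℝ))

/-- The dynamical degree `λ(f) = lim deg(f ^ m) ^ (1 / m)`. -/
noncomputable def dynamicalDegree (f : PolyEnd k n) : ℝ :=
  limUnder atTop f.degreeSeq

/-- `f` is triangular: `fᵢ ∈ k[x₁, …, xᵢ]` for every `i`. -/
def IsTriangular (f : PolyEnd k n) : Prop :=
  ∀ i, f.coord i ∈ supported k (Set.Iic i)

/-- `f` is an affine automorphism: an automorphism of degree `1`. -/
def IsAffineAut (f : PolyEnd k n) : Prop :=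
  IsUnit f ∧ f.degree = 1

/-- `f` is affine-triangular: `f = α ∘ τ` with `α` an affine automorphism and `τ` a
triangular endomorphism. -/
def IsAffineTriangular (f : PolyEnd k n) : Prop :=
  ∃ α τ : PolyEnd k n, α.IsAffineAut ∧ τ.IsTriangular ∧ f = α * τ

/-- The endomorphism `(y + x^r z^t, z, x + z^s (y + x^r z^t))` of affine `3`-space,
where `x = X 0`, `y = X 1`, `z = X 2`. -/
noncomputable def rstMap (k : Type*) [Field k] (r s t : ℕ) : PolyEnd k 3 :=
  ⟨![X 1 + X 0 ^ r * X 2 ^ t, X 2, X 0 + X 2 ^ s * (X 1 + X 0 ^ r * X 2 ^ t)]⟩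

end PolyEnd

/-!
Give the variables positive real weights `μ`. If the part of weight `θ μᵢ` of `fᵢ` dominates, and
these leading parts can be iterated without ever vanishing, then `deg (f ^ m)` grows like `θ ^ m`,
so that `λ(f) = θ`. For `(y + x^r z^t, z, x + z^s (y + x^r z^t))` the leading parts are the
monomials `x^r z^t`, `z`, `x^r z^{s + t}`, and the weights are an eigenvector of the matrix of their
exponents, whose eigenvalues are `0` and the two roots of `x² - (r + s + t) x + r s`.

By the Bruhat decomposition of the linear part, an affine-triangular automorphism of affine
`3`-space is conjugate to the composition of a permutation of the coordinates with a triangular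
automorphism. For each of the six permutations, weights as above or a projection onto fewer
variables show that the dynamical degree is a root of `x² - a x - b` for some natural numbers `a`
and `b`. A number `λ` that is moreover a root of `x² - (r + s + t) x + r s` satisfies
`(r + s + t - a) λ = r s + b` with `r s + b > 0`. It is thus rational, and being integral over `ℤ`
it is an integer.
-/

theorem totalDegree_bind₁_le {σ τ R : Type*} [CommSemiring R] {g : σ → MvPolynomial τ R} {d : ℕ}
    (hg : ∀ i, (g i).totalDegree ≤ d) (p : MvPolynomial σ R) :
    (bind₁ g p).totalDegree ≤ p.totalDegree * d := by
  conv_lhs => rw [p.as_sum, map_sum]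
  refine totalDegree_finsetSum_le fun m hm => ?_
  rw [bind₁_monomial]
  calc (C (coeff m p) * ∏ i ∈ m.support, g i ^ m i).totalDegree
      ≤ (∏ i ∈ m.support, g i ^ m i).totalDegree := by
        simpa only [totalDegree_C, zero_add] using totalDegree_mul (C (coeff m p)) _
    _ ≤ ∑ i ∈ m.support, (g i ^ m i).totalDegree := totalDegree_finsetProd _ _
    _ ≤ ∑ i ∈ m.support, m i * d := Finset.sum_le_sum fun i _ =>
        (totalDegree_pow _ _).trans (Nat.mul_le_mul_left _ (hg i))
    _ = (m.sum fun _ e => e) * d := by rw [Finsupp.sum, Finset.sum_mul]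
    _ ≤ p.totalDegree * d := Nat.mul_le_mul_right _ (le_totalDegree hm)

theorem tendsto_const_rpow_one_div {C : ℝ} (hC : C ≠ 0) :
    Tendsto (fun m : ℕ => C ^ (1 / (m : ℝ))) atTop (𝓝 1) := by
  simpa using (tendsto_const_nhds (x := C)).rpow tendsto_one_div_atTop_nhds_zero_nat (Or.inl hC)

theorem tendsto_const_mul_pow_rpow_one_div {C θ : ℝ} (hC : 0 < C) (hθ : 0 ≤ θ) :
    Tendsto (fun m : ℕ => (C * θ ^ m) ^ (1 / (m : ℝ))) atTop (𝓝 θ) := by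
  have h := (tendsto_const_rpow_one_div hC.ne').mul_const θ
  rw [one_mul] at h
  refine h.congr' ?_
  filter_upwards [eventually_ne_atTop 0] with m hm
  rw [Real.mul_rpow hC.le (by positivity), one_div, Real.pow_rpow_inv_natCast hθ hm]

theorem exists_tendsto_rpow_one_div_of_submultiplicative {u : ℕ → ℕ}
    (hu : ∀ a b, u (a + b) ≤ u a * u b) :
    ∃ l, Tendsto (fun m => (u m : ℝ) ^ (1 / (m : ℝ))) atTop (𝓝 l) := by
  by_cases hpos : ∀ m, 0 < u m
  · have hpos' : ∀ m, (0 : ℝ) < u m := fun m => Nat.cast_pos.mpr (hpos m)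
    have hsub : Subadditive fun m => Real.log (u m) := fun a b => by
      rw [← Real.log_mul (hpos' a).ne' (hpos' b).ne']
      exact Real.log_le_log (hpos' _) (mod_cast hu a b)
    have hbdd : BddBelow (Set.range fun m : ℕ => Real.log (u m) / m) :=
      ⟨0, Set.forall_mem_range.mpr fun m =>
        div_nonneg (Real.log_nonneg (mod_cast hpos m)) m.cast_nonneg⟩
    refine ⟨_, (hsub.tendsto_lim hbdd).rexp.congr fun m => ?_⟩
    rw [Real.rpow_def_of_pos (hpos' m), mul_one_div]
  · push Not at hpos
    obtain ⟨a, ha⟩ := hpos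
    refine ⟨0, tendsto_const_nhds.congr' ?_⟩
    filter_upwards [eventually_ge_atTop a, eventually_ne_atTop 0] with m hm hm0
    have hzero : u m = 0 := by simpa [Nat.add_sub_cancel' hm, Nat.le_zero.mp ha] using hu a (m - a)
    rw [hzero, Nat.cast_zero, Real.zero_rpow (by simpa using hm0)]

namespace PolyEnd

variable {k : Type*} [Field k] {n : ℕ} {f g : PolyEnd k n} {C θ : ℝ}

theorem mul_coord (f g : PolyEnd k n) (i : Fin n) :
    (f * g).coord i = bind₁ g.coord (f.coord i) := rfl

theorem one_coord (i : Fin n) : (1 : PolyEnd k n).coord i = X i := rfl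

theorem totalDegree_coord_le (f : PolyEnd k n) (i : Fin n) :
    (f.coord i).totalDegree ≤ f.degree :=
  Finset.le_sup (f := fun i => (f.coord i).totalDegree) (Finset.mem_univ i)

theorem degree_mul_le (f g : PolyEnd k n) : (f * g).degree ≤ f.degree * g.degree :=
  Finset.sup_le fun i _ => (totalDegree_bind₁_le g.totalDegree_coord_le _).trans
    (Nat.mul_le_mul_right _ (f.totalDegree_coord_le i))

theorem tendsto_degreeSeq (f : PolyEnd k n) : Tendsto f.degreeSeq atTop (𝓝 f.dynamicalDegree) := by
  obtain ⟨l, hl⟩ := exists_tendsto_rpow_one_div_of_submultiplicative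
    (u := fun m => (f ^ m).degree) fun a b => by simpa only [pow_add] using degree_mul_le _ _
  exact tendsto_nhds_limUnder ⟨l, hl⟩

theorem dynamicalDegree_le_of_degree_le (hθ : 0 ≤ θ)
    (h : ∀ m, ((f ^ m).degree : ℝ) ≤ C * θ ^ m) : f.dynamicalDegree ≤ θ := by
  have hC : 0 ≤ C := by simpa using (Nat.cast_nonneg _).trans (h 0)
  refine le_of_tendsto_of_tendsto' f.tendsto_degreeSeq
    (tendsto_const_mul_pow_rpow_one_div (C := C + 1) (by positivity) hθ) fun m => ?_
  refine Real.rpow_le_rpow (Nat.cast_nonneg _) ((h m).trans ?_) (by positivity)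
  gcongr
  exact le_add_of_nonneg_right zero_le_one

theorem le_dynamicalDegree_of_le_degree (hC : 0 < C) (hθ : 0 ≤ θ)
    (h : ∀ m, C * θ ^ m ≤ ((f ^ m).degree : ℝ)) : θ ≤ f.dynamicalDegree :=
  le_of_tendsto_of_tendsto' (tendsto_const_mul_pow_rpow_one_div hC hθ) f.tendsto_degreeSeq
    fun m => Real.rpow_le_rpow (by positivity) (h m) (by positivity)

theorem dynamicalDegree_eq_zero_or_one_le (f : PolyEnd k n) :
    f.dynamicalDegree = 0 ∨ 1 ≤ f.dynamicalDegree := by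
  have hmem : ∀ᶠ m in atTop, f.degreeSeq m ∈ {0} ∪ Set.Ici (1 : ℝ) := by
    filter_upwards [eventually_ne_atTop 0] with m hm
    rcases Nat.eq_zero_or_pos (f ^ m).degree with hdeg | hdeg
    · exact .inl (by rw [degreeSeq, hdeg, Nat.cast_zero]; exact Real.zero_rpow (by simpa using hm))
    · exact .inr (Real.one_le_rpow (mod_cast hdeg) (by positivity))
  exact (isClosed_singleton.union isClosed_Ici).mem_of_tendsto f.tendsto_degreeSeq hmem

theorem dynamicalDegree_le_of_isConj (h : IsConj f g) : g.dynamicalDegree ≤ f.dynamicalDegree := by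
  obtain ⟨c, hc⟩ := h
  set C : ℝ := (c : PolyEnd k n).degree * (↑c⁻¹ : PolyEnd k n).degree + 1 with hC
  have hlim := (tendsto_const_rpow_one_div (C := C) (by positivity)).mul f.tendsto_degreeSeq
  rw [one_mul] at hlim
  refine le_of_tendsto_of_tendsto' g.tendsto_degreeSeq hlim fun m => ?_
  have hpow : g ^ m = c * f ^ m * ↑c⁻¹ :=
    ((Units.mul_inv_eq_iff_eq_mul c).mpr (hc.pow_right m).eq).symm
  have hdeg : (g ^ m).degree ≤ (c : PolyEnd k n).degree * (f ^ m).degree *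
      (↑c⁻¹ : PolyEnd k n).degree := by
    rw [hpow]
    exact (degree_mul_le _ _).trans (Nat.mul_le_mul_right _ (degree_mul_le _ _))
  have hdeg' : ((g ^ m).degree : ℝ) ≤ C * (f ^ m).degree := by
    calc ((g ^ m).degree : ℝ)
        ≤ (c : PolyEnd k n).degree * (f ^ m).degree * (↑c⁻¹ : PolyEnd k n).degree :=
          mod_cast hdeg
      _ ≤ C * (f ^ m).degree := by
          rw [hC, mul_right_comm, add_one_mul]
          exact le_add_of_nonneg_right (Nat.cast_nonneg _)
  rw [degreeSeq, degreeSeq, ← Real.mul_rpow (by positivity) (Nat.cast_nonneg _)]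
  exact Real.rpow_le_rpow (Nat.cast_nonneg _) hdeg' (by positivity)

theorem dynamicalDegree_eq_of_isConj (h : IsConj f g) : f.dynamicalDegree = g.dynamicalDegree :=
  le_antisymm (dynamicalDegree_le_of_isConj h.symm) (dynamicalDegree_le_of_isConj h)

end PolyEnd

section Weights

variable {σ R M : Type*} [CommRing R] [AddCommMonoid M] [PartialOrder M]
  {μ : σ → M} {F F' G G' : MvPolynomial σ R} {W W' : M}

/-- The polynomials all of whose monomials have `μ`-weight at most `W`. -/
noncomputable def weightLE (μ : σ → M) (W : M) : Submodule R (MvPolynomial σ R) :=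
  restrictSupport R {m | Finsupp.weight μ m ≤ W}

/-- The polynomials all of whose monomials have `μ`-weight less than `W`. -/
noncomputable def weightLT (μ : σ → M) (W : M) : Submodule R (MvPolynomial σ R) :=
  restrictSupport R {m | Finsupp.weight μ m < W}

/-- `G` is the part of `μ`-weight `W` of `F`, and `F` has no monomial of larger weight. The
polynomial `G` is allowed to vanish, so `W` is only an upper bound for the weight of `F`. -/
def HasLeadingForm (μ : σ → M) (F : MvPolynomial σ R) (W : M) (G : MvPolynomial σ R) : Prop :=
  IsWeightedHomogeneous μ G W ∧ F - G ∈ weightLT μ W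

theorem weightLE_mono (h : W ≤ W') : (weightLE μ W : Submodule R _) ≤ weightLE μ W' :=
  restrictSupport_mono R fun _ hm => le_trans hm h

theorem weightLT_le_weightLE : (weightLT μ W : Submodule R _) ≤ weightLE μ W :=
  restrictSupport_mono R fun _ hm => le_of_lt hm

theorem weightLE_le_weightLT (h : W < W') : (weightLE μ W : Submodule R _) ≤ weightLT μ W' :=
  restrictSupport_mono R fun _ hm => lt_of_le_of_lt hm h

theorem mem_weightLE_of_isWeightedHomogeneous (h : IsWeightedHomogeneous μ F W) :
    F ∈ weightLE μ W := fun _ hm => (h (mem_support_iff.mp hm)).le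

theorem C_mem_weightLE (c : R) (h : 0 ≤ W) : C c ∈ weightLE μ W :=
  weightLE_mono h (mem_weightLE_of_isWeightedHomogeneous (isWeightedHomogeneous_C μ c))

theorem C_mul_X_mem_weightLE (c : R) {i : σ} (h : μ i ≤ W) : C c * X i ∈ weightLE μ W :=
  weightLE_mono h (mem_weightLE_of_isWeightedHomogeneous ((isWeightedHomogeneous_X R μ i).C_mul c))

theorem C_mul_X_mem_weightLT (c : R) {i : σ} (h : μ i < W) : C c * X i ∈ weightLT μ W :=
  weightLE_le_weightLT h (C_mul_X_mem_weightLE c le_rfl)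

theorem hasLeadingForm_self (h : IsWeightedHomogeneous μ F W) : HasLeadingForm μ F W F :=
  ⟨h, by rw [sub_self]; exact zero_mem _⟩

namespace HasLeadingForm

theorem mem_weightLE (h : HasLeadingForm μ F W G) : F ∈ weightLE μ W := by
  simpa using add_mem (weightLT_le_weightLE h.2) (mem_weightLE_of_isWeightedHomogeneous h.1)

theorem add (h : HasLeadingForm μ F W G) (h' : HasLeadingForm μ F' W G') :
    HasLeadingForm μ (F + F') W (G + G') :=
  ⟨h.1.add h'.1, by rw [add_sub_add_comm]; exact add_mem h.2 h'.2⟩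

theorem add_mem_weightLT (h : HasLeadingForm μ F W G) (h' : F' ∈ weightLT μ W) :
    HasLeadingForm μ (F + F') W G :=
  ⟨h.1, by rw [add_sub_right_comm]; exact add_mem h.2 h'⟩

theorem sum {ι : Type*} {s : Finset ι} {f g : ι → MvPolynomial σ R}
    (h : ∀ i ∈ s, HasLeadingForm μ (f i) W (g i)) :
    HasLeadingForm μ (∑ i ∈ s, f i) W (∑ i ∈ s, g i) :=
  ⟨.sum s g W fun i hi => (h i hi).1,
    by rw [← Finset.sum_sub_distrib]; exact sum_mem fun i hi => (h i hi).2⟩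

theorem mem_support (h : HasLeadingForm μ F W G) {m : σ →₀ ℕ} (hm : m ∈ G.support) :
    m ∈ F.support := by
  by_contra hF
  have hmFG : m ∈ (F - G).support := by simpa [notMem_support_iff.mp hF] using hm
  exact (h.2 hmFG).ne (h.1 (mem_support_iff.mp hm))

end HasLeadingForm

variable [IsOrderedCancelAddMonoid M]

theorem mul_mem_weightLE (h : F ∈ weightLE μ W) (h' : F' ∈ weightLE μ W') :
    F * F' ∈ weightLE μ (W + W') := by
  classical
  intro m hm
  obtain ⟨a, ha, b, hb, rfl⟩ := Finset.mem_add.mp (support_mul _ _ hm)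
  simpa only [Set.mem_ofPred_eq, map_add] using add_le_add (h ha) (h' hb)

theorem mul_mem_weightLT (h : F ∈ weightLT μ W) (h' : F' ∈ weightLE μ W') :
    F * F' ∈ weightLT μ (W + W') := by
  classical
  intro m hm
  obtain ⟨a, ha, b, hb, rfl⟩ := Finset.mem_add.mp (support_mul _ _ hm)
  simpa only [Set.mem_ofPred_eq, map_add] using add_lt_add_of_lt_of_le (h ha) (h' hb)

instance : SetLike.GradedMonoid (weightLE (R := R) μ) where
  one_mem := mem_weightLE_of_isWeightedHomogeneous (isWeightedHomogeneous_one R μ)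
  mul_mem _ _ _ _ := mul_mem_weightLE

namespace HasLeadingForm

theorem mul (h : HasLeadingForm μ F W G) (h' : HasLeadingForm μ F' W' G') :
    HasLeadingForm μ (F * F') (W + W') (G * G') := by
  refine ⟨h.1.mul h'.1, ?_⟩
  rw [show F * F' - G * G' = (F - G) * F' + (F' - G') * G by ring]
  refine add_mem (mul_mem_weightLT h.2 h'.mem_weightLE) ?_
  rw [add_comm]
  exact mul_mem_weightLT h'.2 (mem_weightLE_of_isWeightedHomogeneous h.1)

theorem C_mul (h : HasLeadingForm μ F W G) (c : R) :
    HasLeadingForm μ (C c * F) W (C c * G) := by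
  simpa only [zero_add] using (hasLeadingForm_self (isWeightedHomogeneous_C μ c)).mul h

theorem pow (h : HasLeadingForm μ F W G) (e : ℕ) :
    HasLeadingForm μ (F ^ e) (e • W) (G ^ e) := by
  induction e with
  | zero => simpa using hasLeadingForm_self (isWeightedHomogeneous_one R μ)
  | succ e ih => simpa only [pow_succ, succ_nsmul] using ih.mul h

theorem prod {ι : Type*} {s : Finset ι} {f g : ι → MvPolynomial σ R} {w : ι → M}
    (h : ∀ i ∈ s, HasLeadingForm μ (f i) (w i) (g i)) :
    HasLeadingForm μ (∏ i ∈ s, f i) (∑ i ∈ s, w i) (∏ i ∈ s, g i) := by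
  classical
  induction s using Finset.induction_on with
  | empty => simpa using hasLeadingForm_self (isWeightedHomogeneous_one R μ)
  | insert a s ha ih =>
    rw [Finset.prod_insert ha, Finset.prod_insert ha, Finset.sum_insert ha]
    exact (h a (Finset.mem_insert_self a s)).mul
      (ih fun i hi => h i (Finset.mem_insert_of_mem hi))

end HasLeadingForm

end Weights

section Substitution

variable {σ τ R M N : Type*} [CommRing R] [AddCommMonoid M]
  [AddCommMonoid N] [PartialOrder N] [IsOrderedCancelAddMonoid N]
  {μ : σ → M} {ν : τ → N} {f g : σ → MvPolynomial τ R} {φ : M →+ N}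

theorem bind₁_mem_weightLE [PartialOrder M] {F : MvPolynomial σ R} {W : M} (hφ : Monotone φ)
    (h : ∀ i, f i ∈ weightLE ν (φ (μ i))) (hF : F ∈ weightLE μ W) :
    bind₁ f F ∈ weightLE ν (φ W) := by
  rw [F.as_sum, map_sum]
  refine sum_mem fun m hm => weightLE_mono (hφ (hF hm)) ?_
  rw [bind₁_monomial, ← smul_eq_C_mul, Finsupp.weight_apply, Finsupp.sum, map_sum]
  simp only [map_nsmul]
  exact Submodule.smul_mem _ _ (SetLike.prod_pow_mem_graded _ _ _ _ fun i _ => h i)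

theorem hasLeadingForm_bind₁_monomial
    (h : ∀ i, HasLeadingForm ν (f i) (φ (μ i)) (g i)) (m : σ →₀ ℕ) (c : R) :
    HasLeadingForm ν (bind₁ f (monomial m c)) (φ (Finsupp.weight μ m))
      (bind₁ g (monomial m c)) := by
  rw [bind₁_monomial, bind₁_monomial, Finsupp.weight_apply, Finsupp.sum, map_sum]
  refine (HasLeadingForm.prod fun i _ => ?_).C_mul c
  rw [map_nsmul]
  exact (h i).pow (m i)

theorem HasLeadingForm.bind₁ [PartialOrder M] {F G : MvPolynomial σ R} {W : M} (hφ : StrictMono φ)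
    (h : ∀ i, HasLeadingForm ν (f i) (φ (μ i)) (g i)) (hF : HasLeadingForm μ F W G) :
    HasLeadingForm ν (bind₁ f F) (φ W) (bind₁ g G) := by
  have hG : HasLeadingForm ν (MvPolynomial.bind₁ f G) (φ W) (MvPolynomial.bind₁ g G) := by
    rw [G.as_sum, map_sum, map_sum]
    refine HasLeadingForm.sum fun m hm => ?_
    rw [← hF.1 (mem_support_iff.mp hm)]
    exact hasLeadingForm_bind₁_monomial h m _
  have hrest : MvPolynomial.bind₁ f (F - G) ∈ weightLT ν (φ W) := by
    rw [(F - G).as_sum, map_sum]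
    exact sum_mem fun m hm =>
      weightLE_le_weightLT (hφ (hF.2 hm)) (hasLeadingForm_bind₁_monomial h m _).mem_weightLE
  simpa only [map_sub, add_sub_cancel] using hG.add_mem_weightLT hrest

end Substitution

theorem totalDegree_le_of_mem_weightLE {σ R : Type*} [CommRing R] {μ : σ → ℝ} {S W : ℝ}
    {F : MvPolynomial σ R} (hS : ∀ i, 1 ≤ S * μ i) (hS0 : 0 ≤ S) (hW : 0 ≤ W)
    (hF : F ∈ weightLE μ W) : F.totalDegree ≤ S * W := by
  rcases eq_or_ne F 0 with rfl | hF0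
  · simpa using mul_nonneg hS0 hW
  obtain ⟨e, he, hdeg⟩ := Finset.exists_mem_eq_sup _ (support_nonempty.mpr hF0)
    (fun s : σ →₀ ℕ => s.sum fun _ e => e)
  calc (F.totalDegree : ℝ) = ∑ i ∈ e.support, (e i : ℝ) := by
        rw [totalDegree, hdeg, Finsupp.sum, Nat.cast_sum]
    _ ≤ ∑ i ∈ e.support, (e i : ℝ) * (S * μ i) :=
        Finset.sum_le_sum fun i _ => le_mul_of_one_le_right (Nat.cast_nonneg _) (hS i)
    _ = S * Finsupp.weight μ e := by
        simp only [Finsupp.weight_apply, Finsupp.sum, nsmul_eq_mul, Finset.mul_sum, mul_left_comm]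
    _ ≤ S * W := mul_le_mul_of_nonneg_left (hF he) hS0

theorem HasLeadingForm.le_totalDegree_mul {σ R : Type*} [CommRing R] {μ : σ → ℝ} {b W : ℝ}
    {F G : MvPolynomial σ R} (hb : ∀ i, μ i ≤ b) (hb0 : 0 ≤ b) (hF : HasLeadingForm μ F W G)
    (hG : G ≠ 0) : W ≤ F.totalDegree * b := by
  obtain ⟨e, he⟩ := support_nonempty.mpr hG
  calc W = Finsupp.weight μ e := (hF.1 (mem_support_iff.mp he)).symm
    _ = ∑ i ∈ e.support, (e i : ℝ) * μ i := by
        simp only [Finsupp.weight_apply, Finsupp.sum, nsmul_eq_mul]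
    _ ≤ ∑ i ∈ e.support, (e i : ℝ) * b := by gcongr with i; exact hb i
    _ = ((e.sum fun _ e => e : ℕ) : ℝ) * b := by
        rw [Finsupp.sum, Nat.cast_sum, Finset.sum_mul]
    _ ≤ F.totalDegree * b := by
        gcongr
        exact le_totalDegree (hF.mem_support he)

namespace PolyEnd

variable {k : Type*} [Field k] {n : ℕ} {f G : PolyEnd k n} {μ : Fin n → ℝ} {θ : ℝ}

theorem hasLeadingForm_pow (hθ : 0 < θ)
    (h : ∀ i, HasLeadingForm μ (f.coord i) (θ * μ i) (G.coord i)) (m : ℕ) (i : Fin n) :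
    HasLeadingForm μ ((f ^ m).coord i) (θ ^ m * μ i) ((G ^ m).coord i) := by
  induction m generalizing i with
  | zero => simpa [one_coord] using hasLeadingForm_self (isWeightedHomogeneous_X k μ i)
  | succ m ih =>
    rw [pow_succ' f, pow_succ' G, mul_coord, mul_coord, pow_succ, mul_assoc]
    have hmono : StrictMono (AddMonoidHom.mulLeft (θ ^ m)) :=
      fun _ _ hab => mul_lt_mul_of_pos_left hab (pow_pos hθ m)
    simpa only [AddMonoidHom.coe_mulLeft] using HasLeadingForm.bind₁ hmono ih (h i)

theorem pow_coord_mem_weightLE (hθ : 0 ≤ θ) (h : ∀ i, f.coord i ∈ weightLE μ (θ * μ i))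
    (m : ℕ) (i : Fin n) : (f ^ m).coord i ∈ weightLE μ (θ ^ m * μ i) := by
  induction m generalizing i with
  | zero =>
    simpa [one_coord] using mem_weightLE_of_isWeightedHomogeneous (isWeightedHomogeneous_X k μ i)
  | succ m ih =>
    rw [pow_succ' f, mul_coord, pow_succ, mul_assoc]
    have hmono : Monotone (AddMonoidHom.mulLeft (θ ^ m)) :=
      fun _ _ hab => mul_le_mul_of_nonneg_left hab (pow_nonneg hθ m)
    simpa only [AddMonoidHom.coe_mulLeft] using bind₁_mem_weightLE hmono ih (h i)

theorem dynamicalDegree_le_of_mem_weightLE (hμ : ∀ i, 0 < μ i) (hθ : 0 ≤ θ)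
    (h : ∀ i, f.coord i ∈ weightLE μ (θ * μ i)) : f.dynamicalDegree ≤ θ := by
  have hμ0 : ∀ i, 0 ≤ μ i := fun i => (hμ i).le
  set S := ∑ i, (μ i)⁻¹
  have hS0 : 0 ≤ S := Finset.sum_nonneg fun i _ => inv_nonneg.mpr (hμ0 i)
  have hSμ : ∀ i, 1 ≤ S * μ i := fun i => (inv_le_iff_one_le_mul₀ (hμ i)).mp <|
    Finset.single_le_sum (f := fun i => (μ i)⁻¹) (fun i _ => inv_nonneg.mpr (hμ0 i))
      (Finset.mem_univ i)
  refine dynamicalDegree_le_of_degree_le (C := S * ∑ i, μ i) hθ fun m => ?_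
  have hcoord : ∀ i, (((f ^ m).coord i).totalDegree : ℝ) ≤ S * (∑ i, μ i) * θ ^ m := fun i => calc
    (((f ^ m).coord i).totalDegree : ℝ)
        ≤ S * (θ ^ m * μ i) := totalDegree_le_of_mem_weightLE hSμ hS0
          (mul_nonneg (pow_nonneg hθ m) (hμ0 i)) (pow_coord_mem_weightLE hθ h m i)
    _ ≤ S * (θ ^ m * ∑ i, μ i) := by
        gcongr
        exact Finset.single_le_sum (fun i _ => hμ0 i) (Finset.mem_univ i)
    _ = S * (∑ i, μ i) * θ ^ m := by ring
  have hbound : 0 ≤ S * (∑ i, μ i) * θ ^ m :=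
    mul_nonneg (mul_nonneg hS0 (Finset.sum_nonneg fun i _ => hμ0 i)) (pow_nonneg hθ m)
  exact (Nat.cast_le.mpr (Finset.sup_le fun i _ => Nat.le_floor (hcoord i))).trans
    (Nat.floor_le hbound)

theorem le_dynamicalDegree_of_hasLeadingForm (hθ : 0 < θ)
    (h : ∀ i, HasLeadingForm μ (f.coord i) (θ * μ i) (G.coord i)) {i : Fin n} (hi : 0 < μ i)
    (hG : ∀ m, (G ^ m).coord i ≠ 0) : θ ≤ f.dynamicalDegree := by
  have hle : ∀ j, μ j ≤ ∑ j, |μ j| := fun j =>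
    (le_abs_self _).trans (Finset.single_le_sum (f := fun j => |μ j|)
      (fun _ _ => abs_nonneg _) (Finset.mem_univ j))
  have hpos : 0 < ∑ j, |μ j| := hi.trans_le (hle i)
  refine le_dynamicalDegree_of_le_degree (div_pos hi hpos) hθ.le fun m => ?_
  rw [div_mul_eq_mul_div, div_le_iff₀ hpos, mul_comm (μ i)]
  calc θ ^ m * μ i ≤ ((f ^ m).coord i).totalDegree * ∑ j, |μ j| :=
        (hasLeadingForm_pow hθ h m i).le_totalDegree_mul hle hpos.le (hG m)
    _ ≤ (f ^ m).degree * ∑ j, |μ j| := by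
        gcongr
        exact totalDegree_coord_le _ _

end PolyEnd

section Supported

variable {σ τ R : Type*} [CommSemiring R] {s : Set σ} {t : Set τ} {p : MvPolynomial σ R}

theorem algHom_mem_of_mem_supported {A : Type*} [CommSemiring A] [Algebra R A]
    {φ : MvPolynomial σ R →ₐ[R] A} {S : Subalgebra R A} (hp : p ∈ supported R s)
    (h : ∀ i ∈ s, φ (X i) ∈ S) : φ p ∈ S := by
  have hle : Algebra.adjoin R (X '' s) ≤ S.comap φ :=
    Algebra.adjoin_le (Set.forall_mem_image.mpr h)
  exact hle hp

theorem algHom_eq_of_mem_supported {A : Type*} [CommSemiring A] [Algebra R A]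
    {φ ψ : MvPolynomial σ R →ₐ[R] A} (hp : p ∈ supported R s)
    (h : ∀ i ∈ s, φ (X i) = ψ (X i)) : φ p = ψ p :=
  algHom_mem_of_mem_supported (φ := .id R _) (S := AlgHom.equalizer φ ψ) hp h

theorem bind₁_mem_supported {v : σ → MvPolynomial τ R} (hp : p ∈ supported R s)
    (h : ∀ i ∈ s, v i ∈ supported R t) : bind₁ v p ∈ supported R t :=
  algHom_mem_of_mem_supported hp fun i hi => by rw [bind₁_X_right]; exact h i hi

theorem bind₁_eq_self_of_mem_supported {v : σ → MvPolynomial σ R} (hp : p ∈ supported R s)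
    (h : ∀ i ∈ s, v i = X i) : bind₁ v p = p :=
  algHom_eq_of_mem_supported (ψ := AlgHom.id R _) hp fun i hi => by
    rw [bind₁_X_right]; exact h i hi

theorem C_mem_supported (c : R) : C c ∈ supported R s := (supported R s).algebraMap_mem c

end Supported

section Isolate

variable {σ τ R : Type*} [CommSemiring R] [DecidableEq σ] {s : Set σ} {i : σ}
  {p : MvPolynomial σ R}

/-- View a polynomial as a univariate polynomial in the variable `X i`. Its coefficients are kept
in `MvPolynomial σ R`, although they do not involve `X i`. -/
noncomputable def isolate (i : σ) : MvPolynomial σ R →ₐ[R] Polynomial (MvPolynomial σ R) :=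
  aeval fun j => if j = i then Polynomial.X else Polynomial.C (X j)

theorem isolate_X_self : isolate (R := R) i (X i) = Polynomial.X := by
  simp [isolate]

theorem isolate_X_of_ne {j : σ} (h : j ≠ i) : isolate (R := R) i (X j) = Polynomial.C (X j) := by
  simp [isolate, h]

theorem isolate_eq_C_of_mem_supported (hp : p ∈ supported R s) (hi : i ∉ s) :
    isolate i p = Polynomial.C p :=
  algHom_eq_of_mem_supported (ψ := Polynomial.CAlgHom (R := R)) hp fun _ hj =>
    isolate_X_of_ne (ne_of_mem_of_not_mem hj hi)

theorem eval_X_isolate (i : σ) (p : MvPolynomial σ R) : (isolate i p).eval (X i) = p := by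
  suffices ((Polynomial.aeval (X i)).restrictScalars R).comp (isolate i) = .id R _ by
    simpa [Polynomial.coe_aeval_eq_eval] using DFunLike.congr_fun this p
  refine algHom_ext fun j => ?_
  rcases eq_or_ne j i with rfl | h
  · simp [isolate_X_self]
  · simp [isolate_X_of_ne h]

theorem coeff_isolate_mem_supported (hp : p ∈ supported R s) (e : ℕ) :
    (isolate i p).coeff e ∈ supported R (s \ {i}) := by
  have hmem : isolate i p ∈ (Polynomial.mapAlgHom (supported R (s \ {i})).val).range := by
    refine algHom_mem_of_mem_supported hp fun j hj => ?_
    rcases eq_or_ne j i with rfl | h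
    · exact ⟨Polynomial.X, by simp [isolate_X_self]⟩
    · exact ⟨Polynomial.C ⟨X j, Algebra.subset_adjoin (Set.mem_image_of_mem X ⟨hj, h⟩)⟩,
        by simp [isolate_X_of_ne h]⟩
  obtain ⟨P, hP⟩ := hmem
  rw [← hP]
  simp

theorem natDegree_isolate_pos (hi : i ∈ p.vars) : 0 < (isolate i p).natDegree := by
  by_contra! h
  have hp : p = (isolate i p).coeff 0 := by
    conv_lhs => rw [← eval_X_isolate i p, Polynomial.eq_C_of_natDegree_le_zero h,
      Polynomial.eval_C]
  have hsupp := coeff_isolate_mem_supported (i := i) (mem_supported_vars p) 0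
  rw [← hp, mem_supported] at hsupp
  exact (hsupp hi).2 rfl

theorem isolate_bind₁ [DecidableEq τ] {g : σ → MvPolynomial τ R} {j : τ} (hp : p ∈ supported R s)
    (hg : ∀ l ∈ s, l ≠ i → g l ∈ supported R {j}ᶜ) :
    isolate j (bind₁ g p) =
      ((isolate i p).map (bind₁ g : _ →+* MvPolynomial τ R)).comp (isolate j (g i)) := by
  refine algHom_eq_of_mem_supported (φ := (isolate j).comp (bind₁ g))
    (ψ := ((Polynomial.aeval (isolate j (g i))).restrictScalars R).comp
      ((Polynomial.mapAlgHom (bind₁ g)).comp (isolate i))) hp fun l hl => ?_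
  rcases eq_or_ne l i with rfl | hli
  · simp [isolate_X_self]
  · simp [isolate_X_of_ne hli, isolate_eq_C_of_mem_supported (hg l hl hli)]

end Isolate

section Injectivity

variable {σ τ R : Type*} [CommRing R] [IsDomain R] {s : Set σ} {i : σ} {j : τ}
  {p : MvPolynomial σ R} {g : σ → MvPolynomial τ R}

theorem bind₁_eq_zero_of_mem_supported_insert
    (hs : ∀ p ∈ supported R s, bind₁ g p = 0 → p = 0) (hg : ∀ l ∈ s, g l ∈ supported R {j}ᶜ)
    (hj : j ∈ (g i).vars) (hp : p ∈ supported R (insert i s)) (h : bind₁ g p = 0) : p = 0 := by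
  classical
  have hcomp := isolate_bind₁ hp fun l hl hli => hg l (hl.resolve_left hli)
  rw [h, map_zero] at hcomp
  have hmap : (isolate i p).map (bind₁ g : _ →+* MvPolynomial τ R) = 0 := by
    refine (Polynomial.comp_eq_zero_iff.mp hcomp.symm).resolve_right fun hC => ?_
    have hpos := natDegree_isolate_pos hj
    rw [hC.2, Polynomial.natDegree_C] at hpos
    exact hpos.false
  have hzero : isolate i p = 0 := by
    ext1 e
    refine hs _ (supported_mono ?_ (coeff_isolate_mem_supported hp e)) ?_
    · rintro l ⟨hl, hli⟩
      exact hl.resolve_left hli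
    · simpa using congrArg (Polynomial.coeff · e) hmap
  rw [← eval_X_isolate i p, hzero, Polynomial.eval_zero]

theorem bind₁_eq_zero_of_mem_supported_singleton (hj : j ∈ (g i).vars)
    (hp : p ∈ supported R {i}) (h : bind₁ g p = 0) : p = 0 := by
  refine bind₁_eq_zero_of_mem_supported_insert (s := ∅) (fun q hq hzero => ?_) (by simp) hj
    (by rwa [insert_empty_eq]) h
  rw [supported_empty, Algebra.mem_bot] at hq
  obtain ⟨c, rfl⟩ := hq
  rw [algebraMap_eq, bind₁_C_right, C_eq_zero] at hzero
  rw [hzero, map_zero]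

end Injectivity

theorem natDegree_eq_one_and_isUnit_coeff_of_comp_eq_X {R : Type*} [CommRing R] [IsDomain R]
    {P Q : Polynomial R} (h : P.comp Q = Polynomial.X) :
    P.natDegree = 1 ∧ IsUnit (P.coeff 1) := by
  have hdeg : P.natDegree = 1 := by
    have hmul := congrArg Polynomial.natDegree h
    rw [Polynomial.natDegree_comp, Polynomial.natDegree_X] at hmul
    exact Nat.eq_one_of_mul_eq_one_right hmul
  refine ⟨hdeg, .of_mul_eq_one (Q.coeff 1) ?_⟩
  rw [Polynomial.eq_X_add_C_of_natDegree_le_one hdeg.le] at h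
  simpa using congrArg (Polynomial.coeff · 1) h

namespace PolyEnd

variable {k : Type*} [Field k] {n : ℕ}

theorem isUnit_of_mul_eq_one {f g : PolyEnd k n} (h : f * g = 1) (h' : g * f = 1) : IsUnit f :=
  ⟨⟨f, g, h, h'⟩, rfl⟩

theorem bind₁_coord_injective {f : PolyEnd k n} (hf : IsUnit f) :
    Function.Injective (bind₁ f.coord) := by
  obtain ⟨f, rfl⟩ := hf
  refine Function.LeftInverse.injective (g := bind₁ (f⁻¹).val.coord) fun p => ?_
  have hinv : (fun i => bind₁ (f⁻¹).val.coord (f.val.coord i)) = X := congrArg coord f.mul_inv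
  rw [bind₁_bind₁, hinv, bind₁_X_left, AlgHom.id_apply]

theorem pow_coord_ne_zero {f : PolyEnd k n} {s : Set (Fin n)}
    (hs : ∀ j ∈ s, f.coord j ∈ supported k s)
    (hf : ∀ p ∈ supported k s, bind₁ f.coord p = 0 → p = 0) {i : Fin n} (hi : i ∈ s) (m : ℕ) :
    (f ^ m).coord i ≠ 0 := by
  suffices h : (f ^ m).coord i ∈ supported k s ∧ (f ^ m).coord i ≠ 0 from h.2
  induction m with
  | zero => exact ⟨X_mem_supported.mpr hi, X_ne_zero i⟩
  | succ m ih =>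
    rw [pow_succ, mul_coord]
    exact ⟨bind₁_mem_supported ih.1 hs, fun h => ih.2 (hf _ ih.1 h)⟩

theorem IsTriangular.mul {f g : PolyEnd k n} (hf : f.IsTriangular) (hg : g.IsTriangular) :
    (f * g).IsTriangular := fun i => bind₁_mem_supported (hf i) fun j hj =>
  supported_mono (Set.Iic_subset_Iic.mpr hj) (hg j)

/-- `p = u xᵢ + w` with `u ≠ 0` a constant and `w` a polynomial in the variables before `xᵢ`: the
shape of the `i`-th coordinate of a triangular automorphism. -/
def IsTriangularCoord (i : Fin n) (p : MvPolynomial (Fin n) k) : Prop :=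
  ∃ u : k, u ≠ 0 ∧ ∃ w ∈ supported k (Set.Iio i), p = C u * X i + w

theorem IsTriangularCoord.mem_supported {i : Fin n} {p : MvPolynomial (Fin n) k}
    (hp : IsTriangularCoord i p) : p ∈ supported k (Set.Iic i) := by
  obtain ⟨u, -, w, hw, rfl⟩ := hp
  exact add_mem (mul_mem (C_mem_supported u) (X_mem_supported.mpr Set.self_mem_Iic))
    (supported_mono Set.Iio_subset_Iic_self hw)

theorem exists_isTriangularCoord_bind₁_eq_X {f : PolyEnd k n} {i : Fin n}
    (hf : ∀ j ≤ i, IsTriangularCoord j (f.coord j)) :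
    ∃ q, IsTriangularCoord i q ∧ bind₁ f.coord q = X i := by
  induction i using WellFoundedLT.induction with
  | ind i ih =>
  obtain ⟨u, hu, w, hw, hfi⟩ := hf i le_rfl
  obtain ⟨w', hw', rfl⟩ : w ∈ (supported k (Set.Iio i)).map (bind₁ f.coord) := by
    refine algHom_mem_of_mem_supported (φ := .id k _) hw fun j hj => ?_
    obtain ⟨q, hq, hqj⟩ := ih j hj fun l hl => hf l (hl.trans (le_of_lt hj))
    exact ⟨q, supported_mono (Set.Iic_subset_Iio.mpr hj) hq.mem_supported, hqj⟩
  refine ⟨C u⁻¹ * X i + -(C u⁻¹ * w'), ⟨u⁻¹, inv_ne_zero hu, _,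
    neg_mem (mul_mem (C_mem_supported _) hw'), rfl⟩, ?_⟩
  have hCu : (C u⁻¹ * C u : MvPolynomial (Fin n) k) = 1 := by
    rw [← C_mul, inv_mul_cancel₀ hu, C_1]
  have hw : (bind₁ f.coord : _ →+* MvPolynomial (Fin n) k) w' = bind₁ f.coord w' := rfl
  rw [hw] at hfi
  simp only [map_add, map_neg, map_mul, bind₁_C_right, bind₁_X_right, hfi]
  linear_combination X i * hCu

theorem exists_mul_eq_one_of_isTriangularCoord {f : PolyEnd k n}
    (hf : ∀ i, IsTriangularCoord i (f.coord i)) :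
    ∃ g : PolyEnd k n, (∀ i, IsTriangularCoord i (g.coord i)) ∧ g * f = 1 := by
  choose q hq hqX using fun i => exists_isTriangularCoord_bind₁_eq_X (i := i) fun j _ => hf j
  exact ⟨⟨q⟩, hq, PolyEnd.ext (funext hqX)⟩

theorem isUnit_of_isTriangularCoord {f : PolyEnd k n}
    (hf : ∀ i, IsTriangularCoord i (f.coord i)) : IsUnit f := by
  obtain ⟨g, hg, hgf⟩ := exists_mul_eq_one_of_isTriangularCoord hf
  obtain ⟨h, -, hhg⟩ := exists_mul_eq_one_of_isTriangularCoord hg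
  exact isUnit_of_mul_eq_one (left_inv_eq_right_inv hhg hgf ▸ hhg) hgf

theorem isTriangularCoord_of_natDegree_isolate_le_one {i : Fin n} {p : MvPolynomial (Fin n) k}
    (hp : p ∈ supported k (Set.Iic i)) (hdeg : (isolate i p).natDegree ≤ 1)
    (hunit : IsUnit ((isolate i p).coeff 1)) : IsTriangularCoord i p := by
  obtain ⟨u, hu, hCu⟩ := isUnit_iff_eq_C_of_isReduced.mp hunit
  refine ⟨u, hu.ne_zero, _, supported_mono ?_ (coeff_isolate_mem_supported (i := i) hp 0), ?_⟩
  · rintro j ⟨hji, hne⟩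
    exact lt_of_le_of_ne hji hne
  · conv_lhs => rw [← eval_X_isolate i p, Polynomial.eq_X_add_C_of_natDegree_le_one hdeg, hCu]
    simp

theorem IsTriangular.isTriangularCoord {f : PolyEnd k n} (hf : f.IsTriangular) (hu : IsUnit f)
    (i : Fin n) : IsTriangularCoord i (f.coord i) := by
  induction i using WellFoundedLT.induction with
  | ind i ih =>
  obtain ⟨f, rfl⟩ := hu
  set g : PolyEnd k n := (f⁻¹).val
  have hg (j : Fin n) (hj : j < i) : g.coord j ∈ supported k (Set.Iic j) := by
    obtain ⟨q, hq, hqX⟩ := exists_isTriangularCoord_bind₁_eq_X fun l hl => ih l (hl.trans_lt hj)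
    have hgX : bind₁ f.val.coord (g.coord j) = X j := congrFun (congrArg coord f.inv_mul) j
    rw [bind₁_coord_injective f.isUnit (hgX.trans hqX.symm)]
    exact hq.mem_supported
  have hcomp := isolate_bind₁ (g := g.coord) (j := i) (hf i) fun l hl hli =>
    supported_mono (fun m hm => ne_of_lt (lt_of_le_of_lt hm (lt_of_le_of_ne hl hli)))
      (hg l (lt_of_le_of_ne hl hli))
  have hfg : bind₁ g.coord (f.val.coord i) = X i := congrFun (congrArg coord f.mul_inv) i
  rw [hfg, isolate_X_self] at hcomp
  obtain ⟨hdeg, hunit⟩ := natDegree_eq_one_and_isUnit_coeff_of_comp_eq_X hcomp.symm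
  have hinj : Function.Injective (bind₁ g.coord) := bind₁_coord_injective f⁻¹.isUnit
  rw [Polynomial.natDegree_map_eq_of_injective
    (f := RingHomClass.toRingHom (bind₁ g.coord)) hinj] at hdeg
  rw [Polynomial.coeff_map] at hunit
  refine isTriangularCoord_of_natDegree_isolate_le_one (hf i) hdeg.le ?_
  obtain ⟨u, hu, hCu⟩ := isUnit_iff_eq_C_of_isReduced.mp hunit
  rw [hinj (hCu.trans (bind₁_C_right _ u).symm)]
  exact hu.map C

theorem IsTriangular.inv {f g : PolyEnd k n} (hf : f.IsTriangular) (h : f * g = 1)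
    (h' : g * f = 1) : g.IsTriangular := by
  obtain ⟨q, hq, hqf⟩ := exists_mul_eq_one_of_isTriangularCoord
    (hf.isTriangularCoord (isUnit_of_mul_eq_one h h'))
  rw [← left_inv_eq_right_inv hqf h]
  exact fun i => (hq i).mem_supported

end PolyEnd

section Bruhat

variable {k : Type*} [Field k] {ι : Type*} [LinearOrder ι]

/-- `i` is the position of the first nonzero entry of the vector `w`. -/
def IsLeadingIndex (w : ι → k) (i : ι) : Prop := w i ≠ 0 ∧ ∀ l < i, w l = 0

theorem exists_isLeadingIndex [Finite ι] {w : ι → k} (hw : w ≠ 0) : ∃ i, IsLeadingIndex w i := by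
  obtain ⟨i, hi, hmin⟩ := {i | w i ≠ 0}.toFinite.exists_minimal (Function.ne_iff.mp hw)
  exact ⟨i, hi, fun l hl => by_contra fun hwl => hl.not_ge (hmin hwl hl.le)⟩

theorem exists_isLeadingIndex_forall_le [Finite ι] {S : Set (ι → k)} (hS : S.Nonempty)
    (h0 : 0 ∉ S) :
    ∃ w ∈ S, ∃ i, IsLeadingIndex w i ∧ ∀ w' ∈ S, ∀ l, IsLeadingIndex w' l → l ≤ i := by
  obtain ⟨w, hw⟩ := hS
  obtain ⟨i, hi⟩ := exists_isLeadingIndex (ne_of_mem_of_not_mem hw h0)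
  obtain ⟨i, ⟨w, hw, hwi⟩, hmax⟩ :=
    {i | ∃ w ∈ S, IsLeadingIndex w i}.toFinite.exists_maximal ⟨i, w, hw, hi⟩
  exact ⟨w, hw, i, hwi, fun w' hw' l hl => not_lt.mp fun h => h.not_ge (hmax ⟨w', hw', hl⟩ h.le)⟩

theorem IsLeadingIndex.lt_of_sub_div_smul {w w' : ι → k} {i l : ι} (h : IsLeadingIndex w i)
    (h' : IsLeadingIndex w' i) (hl : IsLeadingIndex (w - (w i / w' i) • w') l) : i < l := by
  refine lt_of_not_ge fun hle => hl.1 ?_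
  rw [Pi.sub_apply, Pi.smul_apply, smul_eq_mul]
  rcases hle.eq_or_lt with rfl | hlt
  · rw [div_mul_cancel₀ _ h'.1, sub_self]
  · rw [h.2 l hlt, h'.2 l hlt, mul_zero, sub_zero]

-- `e j` is the largest leading index of `A *ᵥ u` for the `u` with first nonzero entry `u j = 1`.
-- Two columns cannot share it, since a linear combination of them would have a larger one.
open Matrix in
theorem exists_unitriangular_perm_forall_lt_mul_eq_zero [Fintype ι] {A : Matrix ι ι k}
    (hA : ∀ u, A *ᵥ u = 0 → u = 0) :
    ∃ (U : Matrix ι ι k) (e : Equiv.Perm ι), (∀ j, U j j = 1) ∧ (∀ i j, i < j → U i j = 0) ∧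
      ∀ i j, i < e j → (A * U) i j = 0 := by
  let T (j : ι) : Set (ι → k) := {u | u j = 1 ∧ ∀ i < j, u i = 0}
  have hT {j : ι} {u : ι → k} (hu : u ∈ T j) : A *ᵥ u ≠ 0 := fun h =>
    zero_ne_one ((congrFun (hA u h) j).symm.trans hu.1)
  have hmax (j : ι) := exists_isLeadingIndex_forall_le (S := (A *ᵥ ·) '' T j)
    ⟨_, Pi.single j 1, ⟨Pi.single_eq_same j 1, fun i hi => Pi.single_eq_of_ne hi.ne 1⟩, rfl⟩
    fun ⟨_, hu, hAu⟩ => hT hu hAu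
  choose _ hU e he hle using hmax
  choose U hUT hAU using hU
  obtain rfl : (fun j => A *ᵥ U j) = _ := funext hAU
  have hne (i j : ι) (hij : i < j) : e i ≠ e j := fun heq => by
    set c := (A *ᵥ U i) (e i) / (A *ᵥ U j) (e i)
    have hmem : U i - c • U j ∈ T i :=
      ⟨by simp [(hUT i).1, (hUT j).2 i hij],
        fun l hl => by simp [(hUT i).2 l hl, (hUT j).2 l (hl.trans hij)]⟩
    obtain ⟨l, hl⟩ := exists_isLeadingIndex (hT hmem)
    refine (hle i _ ⟨_, hmem, rfl⟩ l hl).not_gt ?_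
    rw [mulVec_sub, mulVec_smul] at hl
    exact (he i).lt_of_sub_div_smul (heq ▸ he j) hl
  have hinj : Function.Injective e := Function.Injective.of_lt_imp_ne hne
  exact ⟨.of fun i j => U j i, .ofBijective e hinj.bijective_of_finite, fun j => (hUT j).1,
    fun i j hij => (hUT j).2 i hij, fun i j hij => (he j).2 i hij⟩

end Bruhat

theorem exists_eq_C_add_sum_of_totalDegree_le_one {R σ : Type*} [CommSemiring R] [Fintype σ]
    {p : MvPolynomial σ R} (hp : p.totalDegree ≤ 1) :
    ∃ (c : R) (a : σ → R), p = C c + ∑ j, C (a j) * X j := by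
  have hlinear := homogeneousComponent_mem 1 p
  rw [homogeneousSubmodule_one_eq_span_X, Submodule.mem_span_range_iff_exists_fun] at hlinear
  obtain ⟨a, ha⟩ := hlinear
  refine ⟨coeff 0 p, a, ?_⟩
  have hsum : homogeneousComponent 0 p + homogeneousComponent 1 p = p := by
    conv_rhs => rw [← sum_homogeneousComponent p]
    rw [Finset.sum_subset (Finset.range_mono (Nat.succ_le_succ hp)) fun i _ hi =>
      homogeneousComponent_eq_zero i p (by simpa using hi)]
    simp only [Finset.sum_range_succ, Finset.sum_range_zero, zero_add]
  simpa only [homogeneousComponent_zero, ← ha, smul_eq_C_mul] using hsum.symm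

theorem isConj_units_mul {M : Type*} [Monoid M] (γ : Mˣ) (a b : M) :
    IsConj (γ * a * b) (a * (b * γ)) :=
  ⟨γ⁻¹, by simp [SemiconjBy, mul_assoc]⟩

namespace PolyEnd

variable {k : Type*} [Field k] {n : ℕ}

/-- The affine endomorphism `x ↦ A x + c`. -/
noncomputable def affine (A : Matrix (Fin n) (Fin n) k) (c : Fin n → k) : PolyEnd k n :=
  ⟨fun i => C (c i) + ∑ j, C (A i j) * X j⟩

theorem exists_eq_affine_of_degree_le_one {f : PolyEnd k n} (hf : f.degree ≤ 1) :
    ∃ A c, f = affine A c := by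
  choose c A h using fun i =>
    exists_eq_C_add_sum_of_totalDegree_le_one ((f.totalDegree_coord_le i).trans hf)
  exact ⟨A, c, PolyEnd.ext (funext h)⟩

open Matrix in
theorem affine_mul_affine (A B : Matrix (Fin n) (Fin n) k) (c d : Fin n → k) :
    affine A c * affine B d = affine (A * B) (A *ᵥ d + c) := by
  ext1
  funext i
  simp only [mul_coord, affine, map_add, map_sum, map_mul, bind₁_C_right, bind₁_X_right, mul_add,
    Finset.sum_add_distrib, Matrix.mul_apply, Pi.add_apply, mulVec, dotProduct, Finset.mul_sum,
    Finset.sum_mul, mul_assoc]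
  rw [Finset.sum_comm (f := fun j l => C (A i j) * (C (B j l) * X l))]
  ring

open Matrix in
theorem eq_zero_of_mulVec_eq_zero_of_isUnit_affine {A : Matrix (Fin n) (Fin n) k} {c : Fin n → k}
    (hA : IsUnit (affine A c)) {u : Fin n → k} (hu : A *ᵥ u = 0) : u = 0 := by
  have h : affine A c * affine 1 u = affine A c * affine 1 0 := by
    simp only [affine_mul_affine, mul_one, hu, mulVec_zero]
  funext i
  have hi := congrArg constantCoeff (congrFun (congrArg coord (hA.mul_left_cancel h)) i)
  simpa [affine] using hi

theorem isTriangularCoord_affine_of_unitriangular {U : Matrix (Fin n) (Fin n) k}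
    (hdiag : ∀ i, U i i = 1) (hU : ∀ i j, i < j → U i j = 0) (c : Fin n → k) (i : Fin n) :
    IsTriangularCoord i ((affine U c).coord i) := by
  refine ⟨1, one_ne_zero, C (c i) + ∑ j ∈ Finset.univ.erase i, C (U i j) * X j, ?_, ?_⟩
  · refine add_mem (C_mem_supported _) (sum_mem fun j hj => ?_)
    rcases lt_or_gt_of_ne (Finset.ne_of_mem_erase hj) with hji | hij
    · exact mul_mem (C_mem_supported _) (X_mem_supported.mpr hji)
    · rw [hU i j hij, C_0, zero_mul]
      exact zero_mem _
  · have hsum := Finset.add_sum_erase Finset.univ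
      (fun j => C (U i j) * X j : Fin n → MvPolynomial (Fin n) k) (Finset.mem_univ i)
    simp only [affine, ← hsum, hdiag]
    ring

/-- The automorphism permuting the coordinates: `xᵢ ↦ x_{e i}`. -/
noncomputable def perm (k : Type*) [Field k] (e : Equiv.Perm (Fin n)) : PolyEnd k n :=
  ⟨fun i => X (e i)⟩

theorem perm_mul_coord (e : Equiv.Perm (Fin n)) (f : PolyEnd k n) (i : Fin n) :
    (perm k e * f).coord i = f.coord (e i) := bind₁_X_right _ _

theorem perm_mul_perm_symm (e : Equiv.Perm (Fin n)) : perm k e * perm k e.symm = 1 := by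
  ext1
  funext i
  rw [perm_mul_coord, one_coord]
  exact congrArg X (e.symm_apply_apply i)

theorem isTriangular_affine_mul_perm {A : Matrix (Fin n) (Fin n) k} {e : Equiv.Perm (Fin n)}
    (hA : ∀ i j, i < e j → A i j = 0) (c : Fin n → k) : (affine A c * perm k e).IsTriangular := by
  intro i
  rw [mul_coord, affine, map_add, map_sum, bind₁_C_right]
  refine add_mem (C_mem_supported _) (sum_mem fun j _ => ?_)
  rw [map_mul, bind₁_C_right, bind₁_X_right]
  rcases lt_or_ge i (e j) with hij | hij
  · rw [hA i j hij, C_0, zero_mul]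
    exact zero_mem _
  · exact mul_mem (C_mem_supported _) (X_mem_supported.mpr hij)

theorem IsAffineTriangular.exists_isConj_perm_mul {g : PolyEnd k n} (h : g.IsAffineTriangular)
    (hg : IsUnit g) :
    ∃ (e : Equiv.Perm (Fin n)) (τ : PolyEnd k n), IsUnit τ ∧ τ.IsTriangular ∧
      IsConj g (perm k e * τ) := by
  obtain ⟨_, τ, ⟨⟨α, rfl⟩, hdeg⟩, hτ, rfl⟩ := h
  obtain ⟨A, c, hA⟩ := exists_eq_affine_of_degree_le_one hdeg.le
  obtain ⟨U, e, hdiag, hU, hAU⟩ := exists_unitriangular_perm_forall_lt_mul_eq_zero fun u =>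
    eq_zero_of_mulVec_eq_zero_of_isUnit_affine (hA ▸ α.isUnit)
  have hU_coord := isTriangularCoord_affine_of_unitriangular hdiag hU 0
  obtain ⟨β, hβ⟩ := isUnit_of_isTriangularCoord hU_coord
  have hβ_tri : β.val.IsTriangular := hβ ▸ fun i => (hU_coord i).mem_supported
  let p : (PolyEnd k n)ˣ :=
    ⟨perm k e, perm k e.symm, perm_mul_perm_symm e, perm_mul_perm_symm e.symm⟩
  have hγ_tri : (α * β * p).val.IsTriangular := by
    rw [Units.val_mul, Units.val_mul, hA, hβ, affine_mul_affine]
    exact isTriangular_affine_mul_perm hAU _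
  have hτ_unit : IsUnit τ := (Units.isUnit_units_mul α τ).mp hg
  refine ⟨e.symm, (β⁻¹).val * τ * (α * β * p).val, ?_, ?_, ?_⟩
  · exact (β⁻¹.isUnit.mul hτ_unit).mul (α * β * p).isUnit
  · exact ((hβ_tri.inv β.mul_inv β.inv_mul).mul hτ).mul hγ_tri
  · have hατ : α.val * τ = (α * β * p).val * (p⁻¹).val * ((β⁻¹).val * τ) := by
      simp [mul_assoc]
    rw [hατ]
    exact isConj_units_mul _ _ _

end PolyEnd

section Quadratic

/-- The larger real root of `x² - b x + c`, provided that `4 c ≤ b²`. -/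
noncomputable def largerRoot (b c : ℝ) : ℝ := (b + √(b ^ 2 - 4 * c)) / 2

variable {b c x : ℝ}

theorem lt_largerRoot (h : x ^ 2 - b * x + c < 0) : x < largerRoot b c := by
  have hsqrt : 2 * x - b < √(b ^ 2 - 4 * c) :=
    Real.lt_sqrt_of_sq_lt (by linear_combination 4 * h)
  rw [largerRoot]
  linarith

theorem quadratic_nonneg_of_largerRoot_le (h : largerRoot b c ≤ x) : 0 ≤ x ^ 2 - b * x + c := by
  by_contra! hneg
  exact (lt_largerRoot hneg).not_ge h

theorem quadratic_largerRoot_eq_zero (h : 4 * c ≤ b ^ 2) :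
    largerRoot b c ^ 2 - b * largerRoot b c + c = 0 := by
  have hsq := Real.sq_sqrt (sub_nonneg.mpr h)
  rw [largerRoot]
  linear_combination hsq / 4

theorem isGreatest_largerRoot (h : 4 * c ≤ b ^ 2) :
    IsGreatest {x : ℝ | x ^ 2 - b * x + c = 0} (largerRoot b c) := by
  refine ⟨quadratic_largerRoot_eq_zero h, fun x (hx : x ^ 2 - b * x + c = 0) => ?_⟩
  have hsqrt : 2 * x - b ≤ √(b ^ 2 - 4 * c) :=
    Real.le_sqrt_of_sq_le (by linear_combination 4 * hx)
  rw [largerRoot]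
  linarith

/-- `x` is a root of `X² - a X - b` for some natural numbers `a` and `b`. This is what the dynamical
degrees of the affine-triangular automorphisms of affine `3`-space have in common. -/
def IsNatQuadratic (x : ℝ) : Prop := ∃ a b : ℕ, x ^ 2 = a * x + b

theorem isNatQuadratic_natCast (m : ℕ) : IsNatQuadratic m := ⟨m, 0, by push_cast; ring⟩

theorem IsNatQuadratic.exists_int_eq (hx : IsNatQuadratic x) {b c : ℕ} (hc : 0 < c)
    (h : x ^ 2 - b * x + c = 0) : ∃ m : ℤ, x = m := by
  obtain ⟨a, d, had⟩ := hx
  have hlin : (b - a : ℝ) * x = c + d := by linear_combination had - h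
  have hne : (b - a : ℝ) ≠ 0 := fun h0 => by
    rw [h0, zero_mul] at hlin
    exact absurd hlin (by positivity)
  obtain ⟨q, rfl⟩ : ∃ q : ℚ, x = q := ⟨(c + d) / (b - a), by
    push_cast
    rw [eq_div_iff hne, mul_comm, hlin]⟩
  have hint : IsIntegral ℤ q := by
    refine ⟨Polynomial.X ^ 2 - Polynomial.C (b : ℤ) * Polynomial.X + Polynomial.C (c : ℤ),
      by monicity!, ?_⟩
    simp only [Polynomial.eval₂_add, Polynomial.eval₂_sub, Polynomial.eval₂_mul,
      Polynomial.eval₂_pow, Polynomial.eval₂_X, Polynomial.eval₂_C]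
    exact_mod_cast h
  obtain ⟨m, rfl⟩ := IsIntegrallyClosed.isIntegral_iff.mp hint
  exact ⟨m, by simp⟩

end Quadratic

section WeightBounds

variable {σ R : Type*} [CommRing R] {μ : σ → ℝ} {p : MvPolynomial σ R} {i j : σ} {W : ℝ}

theorem hasLeadingForm_X (i : σ) : HasLeadingForm μ (X i : MvPolynomial σ R) (μ i) (X i) :=
  hasLeadingForm_self (isWeightedHomogeneous_X R μ i)

theorem hasLeadingForm_C_mul_X_add_C (a e : R) (hi : 0 < μ i) :
    HasLeadingForm μ (C a * X i + C e) (μ i) (C a * X i) :=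
  ((hasLeadingForm_X i).C_mul a).add_mem_weightLT
    (weightLE_le_weightLT hi (C_mem_weightLE e le_rfl))

theorem mem_weightLE_of_sum_degreeOf_le {s : Finset σ} (hp : p ∈ supported R (s : Set σ))
    (hμ : ∀ i ∈ s, 0 ≤ μ i) (h : ∑ i ∈ s, degreeOf i p * μ i ≤ W) : p ∈ weightLE μ W := by
  intro m hm
  have hms : m.support ⊆ s :=
    (support_subset_vars_of_mem_support hm).trans (Finset.coe_subset.mp (mem_supported.mp hp))
  calc Finsupp.weight μ m = ∑ i ∈ s, (m i : ℝ) * μ i := by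
        rw [Finsupp.weight_apply, Finsupp.sum_of_support_subset m hms _ fun i _ => zero_nsmul (μ i)]
        simp only [nsmul_eq_mul]
    _ ≤ ∑ i ∈ s, (degreeOf i p : ℝ) * μ i := by
        refine Finset.sum_le_sum fun i hi => mul_le_mul_of_nonneg_right ?_ (hμ i hi)
        exact_mod_cast monomial_le_degreeOf i hm
    _ ≤ W := h

theorem mem_weightLE_of_mem_supported_singleton (hp : p ∈ supported R {i}) (hi : 0 ≤ μ i)
    (h : degreeOf i p * μ i ≤ W) : p ∈ weightLE μ W :=
  mem_weightLE_of_sum_degreeOf_le (s := {i}) (by simpa using hp) (by simpa using hi)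
    (by simpa using h)

theorem mem_weightLE_of_mem_supported_pair (hp : p ∈ supported R {i, j}) (hij : i ≠ j)
    (hi : 0 ≤ μ i) (hj : 0 ≤ μ j) (h : degreeOf i p * μ i + degreeOf j p * μ j ≤ W) :
    p ∈ weightLE μ W := by
  classical
  exact mem_weightLE_of_sum_degreeOf_le (s := {i, j}) (by simpa using hp) (by simp [hi, hj])
    (by rwa [Finset.sum_pair hij])

theorem exists_mem_support_eq_degreeOf (hp : p ≠ 0) (i : σ) :
    ∃ m ∈ p.support, m i = degreeOf i p := by
  obtain ⟨m, hm, h⟩ :=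
    Finset.exists_mem_eq_sup _ (support_nonempty.mpr hp) fun m : σ →₀ ℕ => m i
  exact ⟨m, hm, by rw [degreeOf_eq_sup, h]⟩

theorem mem_support_weightedHomogeneousComponent {m : σ →₀ ℕ} :
    m ∈ (weightedHomogeneousComponent μ W p).support ↔
      m ∈ p.support ∧ Finsupp.weight μ m = W := by
  classical
  rw [mem_support_iff, mem_support_iff, coeff_weightedHomogeneousComponent, ite_ne_right_iff,
    and_comm]

theorem hasLeadingForm_weightedHomogeneousComponent (hp : p ∈ weightLE μ W) :
    HasLeadingForm μ p W (weightedHomogeneousComponent μ W p) := by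
  classical
  refine ⟨weightedHomogeneousComponent_isWeightedHomogeneous W p, fun m hm => ?_⟩
  have hcoeff : coeff m (p - weightedHomogeneousComponent μ W p) ≠ 0 := mem_support_iff.mp hm
  rw [coeff_sub, coeff_weightedHomogeneousComponent] at hcoeff
  split_ifs at hcoeff with hmW
  · simp at hcoeff
  · rw [sub_zero] at hcoeff
    exact (hp (mem_support_iff.mpr hcoeff)).lt_of_ne hmW

theorem weightedHomogeneousComponent_mem_supported {s : Set σ} (hp : p ∈ supported R s) :
    weightedHomogeneousComponent μ W p ∈ supported R s := by
  refine mem_supported.mpr fun i hi => mem_supported.mp hp ?_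
  obtain ⟨m, hm, him⟩ := (mem_vars_iff_mem_support i).mp hi
  exact support_subset_vars_of_mem_support (mem_support_weightedHomogeneousComponent.mp hm).1 him

theorem vars_nonempty_of_isWeightedHomogeneous (hp : IsWeightedHomogeneous μ p W) (h0 : p ≠ 0)
    (hW : W ≠ 0) : p.vars.Nonempty := by
  obtain ⟨m, hm⟩ := support_nonempty.mpr h0
  have hm0 : m ≠ 0 := by
    rintro rfl
    exact hW ((hp (mem_support_iff.mp hm)).symm.trans (map_zero _))
  obtain ⟨i, hi⟩ := Finsupp.support_nonempty_iff.mpr hm0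
  exact ⟨i, support_subset_vars_of_mem_support hm hi⟩

end WeightBounds

namespace PolyEnd

variable {k : Type*} [Field k]

theorem pow_coord_ne_zero_of_mem_supported_singleton {n : ℕ} {G : PolyEnd k n} {i : Fin n}
    (hG : G.coord i ∈ supported k {i}) (hi : i ∈ (G.coord i).vars) (m : ℕ) :
    (G ^ m).coord i ≠ 0 :=
  pow_coord_ne_zero (s := {i}) (by simpa using hG)
    (fun _ hp => bind₁_eq_zero_of_mem_supported_singleton hi hp) rfl m

theorem pow_coord_ne_zero_of_mem_supported_pair {n : ℕ} {G : PolyEnd k n} {i i' j j' : Fin n}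
    (hG : G.coord i ∈ supported k {i, i'}) (hG' : G.coord i' ∈ supported k {i, i'})
    (hj : j ∈ (G.coord i).vars) (hj' : j' ∈ (G.coord i').vars)
    (hjG' : G.coord i' ∈ supported k {j}ᶜ) (m : ℕ) : (G ^ m).coord i ≠ 0 :=
  pow_coord_ne_zero (s := {i, i'}) (by simpa using ⟨hG, hG'⟩)
    (fun _ hp => bind₁_eq_zero_of_mem_supported_insert
      (fun _ hq => bind₁_eq_zero_of_mem_supported_singleton hj' hq) (by simpa using hjG') hj hp)
    (Set.mem_insert i _) m

end PolyEnd

section ThreeVariables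

variable {k : Type*} [Field k]

theorem forall_fin_three {P : Fin 3 → Prop} (h₀ : P 0) (h₁ : P 1) (h₂ : P 2) (i : Fin 3) : P i := by
  fin_cases i
  exacts [h₀, h₁, h₂]

namespace PolyEnd

variable {p₀ p₁ p₂ g₀ g₁ g₂ : MvPolynomial (Fin 3) k} {a b c θ : ℝ}

theorem ext_three {f g : PolyEnd k 3} (h₀ : f.coord 0 = g.coord 0) (h₁ : f.coord 1 = g.coord 1)
    (h₂ : f.coord 2 = g.coord 2) : f = g :=
  PolyEnd.ext (funext (forall_fin_three h₀ h₁ h₂))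

theorem dynamicalDegree_le_of_mem_weightLE_three (ha : 0 < a) (hb : 0 < b) (hc : 0 < c)
    (hθ : 0 ≤ θ) (h₀ : p₀ ∈ weightLE ![a, b, c] (θ * a)) (h₁ : p₁ ∈ weightLE ![a, b, c] (θ * b))
    (h₂ : p₂ ∈ weightLE ![a, b, c] (θ * c)) : (mk ![p₀, p₁, p₂]).dynamicalDegree ≤ θ :=
  dynamicalDegree_le_of_mem_weightLE (forall_fin_three ha hb hc) hθ (forall_fin_three h₀ h₁ h₂)

theorem le_dynamicalDegree_of_hasLeadingForm_three (hθ : 0 < θ) (ha : 0 < a)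
    (h₀ : HasLeadingForm ![a, b, c] p₀ (θ * a) g₀) (h₁ : HasLeadingForm ![a, b, c] p₁ (θ * b) g₁)
    (h₂ : HasLeadingForm ![a, b, c] p₂ (θ * c) g₂) (hG : ∀ m, (mk ![g₀, g₁, g₂] ^ m).coord 0 ≠ 0) :
    θ ≤ (mk ![p₀, p₁, p₂]).dynamicalDegree :=
  le_dynamicalDegree_of_hasLeadingForm (G := mk ![g₀, g₁, g₂]) hθ (forall_fin_three h₀ h₁ h₂)
    (i := 0) ha hG

end PolyEnd

end ThreeVariables

section Family

variable {r s t : ℕ}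

theorem add_one_lt_largerRoot (hr : 1 ≤ r) (ht : 1 ≤ t) :
    (s + 1 : ℝ) < largerRoot (r + s + t) (r * s) := by
  have hr' : (1 : ℝ) ≤ r := Nat.one_le_cast.mpr hr
  have ht' : (1 : ℝ) ≤ t := Nat.one_le_cast.mpr ht
  refine lt_largerRoot ?_
  nlinarith [mul_nonneg s.cast_nonneg (sub_nonneg.mpr ht')]

theorem four_mul_mul_le_add_add_sq : 4 * (r * s : ℝ) ≤ (r + s + t) ^ 2 := by
  have ht : (0 : ℝ) ≤ 2 * (r + s) * t + t ^ 2 := by positivity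
  linear_combination sq_nonneg (r - s : ℝ) + ht

namespace PolyEnd

variable {k : Type*} [Field k]

theorem isUnit_rstMap : IsUnit (rstMap k r s t) := by
  refine isUnit_of_mul_eq_one (g := ⟨![X 2 - X 1 ^ s * X 0,
    X 0 - (X 2 - X 1 ^ s * X 0) ^ r * X 1 ^ t, X 1]⟩) (ext_three ?_ ?_ ?_) (ext_three ?_ ?_ ?_) <;>
  simp [mul_coord, one_coord, rstMap]

variable {θ : ℝ}

theorem hasLeadingForm_rstMap_zero (hθ : 1 < θ * (θ - s))
    (hroot : θ ^ 2 - (r + s + t) * θ + r * s = 0) :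
    HasLeadingForm ![θ - s, 1, θ] (X 1 + X 0 ^ r * X 2 ^ t : MvPolynomial (Fin 3) k)
      (θ * (θ - s)) (X 0 ^ r * X 2 ^ t) := by
  have h := ((hasLeadingForm_X (R := k) (μ := ![θ - s, 1, θ]) 0).pow r).mul
    ((hasLeadingForm_X 2).pow t)
  have hW : r • (θ - s) + t • θ = θ * (θ - s) := by
    simp only [nsmul_eq_mul]
    linear_combination -hroot
  rw [add_comm, ← hW]
  exact h.add_mem_weightLT
    (weightLE_le_weightLT (hW ▸ hθ) (hasLeadingForm_X 1).mem_weightLE)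

theorem hasLeadingForm_rstMap_two (hθ : 1 < θ * (θ - s)) (hs : θ - s < θ * θ)
    (hroot : θ ^ 2 - (r + s + t) * θ + r * s = 0) :
    HasLeadingForm ![θ - s, 1, θ]
      (X 0 + X 2 ^ s * (X 1 + X 0 ^ r * X 2 ^ t) : MvPolynomial (Fin 3) k) (θ * θ)
      (X 2 ^ s * (X 0 ^ r * X 2 ^ t)) := by
  have h := ((hasLeadingForm_X (R := k) (μ := ![θ - s, 1, θ]) 2).pow s).mul
    (hasLeadingForm_rstMap_zero hθ hroot)
  have hW : s • θ + θ * (θ - s) = θ * θ := by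
    simp only [nsmul_eq_mul]
    ring
  rw [add_comm, ← hW]
  exact h.add_mem_weightLT
    (weightLE_le_weightLT (hW ▸ hs) (hasLeadingForm_X 0).mem_weightLE)

theorem aeval_one_pow_coord_eq_one {n : ℕ} {G : PolyEnd k n}
    (hG : ∀ i, aeval (fun _ => (1 : k)) (G.coord i) = 1) (m : ℕ) (i : Fin n) :
    aeval (fun _ => (1 : k)) ((G ^ m).coord i) = 1 := by
  induction m generalizing i with
  | zero => rw [pow_zero, one_coord, aeval_X]
  | succ m ih =>
    rw [pow_succ', mul_coord, aeval_bind₁]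
    simp only [ih, hG]

theorem dynamicalDegree_rstMap (hr : 1 ≤ r) (ht : 1 ≤ t) :
    (rstMap k r s t).dynamicalDegree = largerRoot (r + s + t) (r * s) := by
  have hroot := quadratic_largerRoot_eq_zero (four_mul_mul_le_add_add_sq (r := r) (s := s) (t := t))
  have hgt := add_one_lt_largerRoot (s := s) hr ht
  set θ := largerRoot (r + s + t) (r * s)
  have : (0 : ℝ) ≤ s := s.cast_nonneg
  have hx : 0 < θ - s := by linarith
  have hθ : 0 < θ := by linarith
  have h₀ := hasLeadingForm_rstMap_zero (k := k) (by nlinarith) hroot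
  have h₁ : HasLeadingForm ![θ - s, 1, θ] (X 2 : MvPolynomial (Fin 3) k) (θ * 1) (X 2) := by
    rw [mul_one]
    exact hasLeadingForm_X 2
  have h₂ := hasLeadingForm_rstMap_two (k := k) (by nlinarith) (by nlinarith) hroot
  refine le_antisymm (dynamicalDegree_le_of_mem_weightLE_three hx one_pos hθ hθ.le
    h₀.mem_weightLE h₁.mem_weightLE h₂.mem_weightLE)
    (le_dynamicalDegree_of_hasLeadingForm_three hθ hx h₀ h₁ h₂ fun m hzero => ?_)
  have hone := aeval_one_pow_coord_eq_one (k := k)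
    (G := ⟨![X 0 ^ r * X 2 ^ t, X 2, X 2 ^ s * (X 0 ^ r * X 2 ^ t)]⟩)
    (forall_fin_three (by simp) (by simp) (by simp)) m 0
  rw [hzero, map_zero] at hone
  exact zero_ne_one hone

end PolyEnd

end Family

namespace PolyEnd

variable {k : Type*} [Field k]

theorem isNatQuadratic_of_dynamicalDegree_le_one {n : ℕ} {f : PolyEnd k n}
    (h : f.dynamicalDegree ≤ 1) : IsNatQuadratic f.dynamicalDegree := by
  rcases f.dynamicalDegree_eq_zero_or_one_le with h0 | h1
  · rw [h0]
    exact_mod_cast isNatQuadratic_natCast 0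
  · rw [h.antisymm h1]
    exact_mod_cast isNatQuadratic_natCast 1

section Skew

variable {p₀ p₁ p₂ q : MvPolynomial (Fin 3) k} {d : ℕ} {θ : ℝ}

theorem weight_three_of_mem_support (hq : q ∈ supported k {0, 1}) {m : Fin 3 →₀ ℕ}
    (hm : m ∈ q.support) (a b c : ℝ) : Finsupp.weight ![a, b, c] m = m 0 * a + m 1 * b := by
  have h2 : m 2 = 0 := mem_support_notMem_vars_zero hm fun h => by
    simpa using mem_supported.mp hq h
  simp [Finsupp.weight_eq_sum, Fin.sum_univ_three, h2]

/-- If `x`, `y`, `z` have weights `θ`, `d` and a suitable `ν > 0`, then `p₀`, `p₁`, `p₂` have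
weights less than `θ²`, equal to `θ d` and at most `θ ν`, and the leading form of `p₁` depends on
`x` only. In this situation the dynamical degree of `(p₀ + q, p₁, p₂)` can be read off from the
exponents of `q ∈ k[x, y]`. -/
def HasSkewWeights (p₀ p₁ p₂ : MvPolynomial (Fin 3) k) (d : ℕ) (θ : ℝ) : Prop :=
  ∃ ν : ℝ, 0 < ν ∧ p₀ ∈ weightLT ![θ, d, ν] (θ * θ) ∧
    (∃ u ∈ supported k {0}, u ≠ 0 ∧ HasLeadingForm ![θ, d, ν] p₁ (θ * d) u) ∧
    p₂ ∈ weightLE ![θ, d, ν] (θ * ν)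

theorem HasSkewWeights.dynamicalDegree_le (H : HasSkewWeights p₀ p₁ p₂ d θ) (hd : 0 < d)
    (hθ : 0 < θ) (hq : q ∈ supported k {0, 1})
    (hle : ∀ m ∈ q.support, (m 0 * θ + m 1 * d : ℝ) ≤ θ * θ) :
    (mk ![p₀ + q, p₁, p₂]).dynamicalDegree ≤ θ := by
  obtain ⟨ν, hν, h₀, ⟨u, -, -, h₁⟩, h₂⟩ := H
  refine dynamicalDegree_le_of_mem_weightLE_three hθ (Nat.cast_pos.mpr hd) hν hθ.le
    (add_mem (weightLT_le_weightLE h₀) fun m hm => ?_) h₁.mem_weightLE h₂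
  exact (weight_three_of_mem_support hq hm _ _ _).trans_le (hle m hm)

theorem pow_coord_zero_ne_zero {g u w : MvPolynomial (Fin 3) k} (hg : g ∈ supported k {0, 1})
    (hu : u ∈ supported k {0}) (hg' : g.vars.Nonempty) (hu' : u.vars.Nonempty) (m : ℕ) :
    (mk ![g, u, w] ^ m).coord 0 ≠ 0 := by
  by_cases h1 : 1 ∈ g.vars
  · obtain ⟨j, hj⟩ := hu'
    exact pow_coord_ne_zero_of_mem_supported_pair (G := mk ![g, u, w]) (i' := 1) hg
      (supported_mono (by simp) hu) h1 hj (supported_mono (by simp) hu) m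
  · have hg0 : g ∈ supported k {0} := mem_supported.mpr fun i hi => by
      have hi01 : i = 0 ∨ i = 1 := mem_supported.mp hg hi
      exact hi01.resolve_right fun h => h1 (h ▸ hi)
    obtain ⟨j, hj⟩ := hg'
    obtain rfl : j = 0 := mem_supported.mp hg0 hj
    exact pow_coord_ne_zero_of_mem_supported_singleton (G := mk ![g, u, w]) hg0 hj m

theorem HasSkewWeights.le_dynamicalDegree (H : HasSkewWeights p₀ p₁ p₂ d θ) (hd : 0 < d)
    (hθ : 0 < θ) (hq : q ∈ supported k {0, 1})
    (hle : ∀ m ∈ q.support, (m 0 * θ + m 1 * d : ℝ) ≤ θ * θ) {m : Fin 3 →₀ ℕ}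
    (hm : m ∈ q.support) (heq : (m 0 * θ + m 1 * d : ℝ) = θ * θ) :
    θ ≤ (mk ![p₀ + q, p₁, p₂]).dynamicalDegree := by
  obtain ⟨ν, _, h₀, ⟨u, hu, hu0, h₁⟩, h₂⟩ := H
  have hlead := hasLeadingForm_weightedHomogeneousComponent (μ := ![θ, d, ν]) (W := θ * θ)
    (p := q) fun m hm => (weight_three_of_mem_support hq hm _ _ _).trans_le (hle m hm)
  have hne : weightedHomogeneousComponent ![θ, d, ν] (θ * θ) q ≠ 0 :=
    support_nonempty.mp ⟨m, mem_support_weightedHomogeneousComponent.mpr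
      ⟨hm, (weight_three_of_mem_support hq hm _ _ _).trans heq⟩⟩
  have : (0 : ℝ) < d := Nat.cast_pos.mpr hd
  refine le_dynamicalDegree_of_hasLeadingForm_three hθ hθ
    (by rw [add_comm]; exact hlead.add_mem_weightLT h₀) h₁
    (hasLeadingForm_weightedHomogeneousComponent h₂)
    (pow_coord_zero_ne_zero (weightedHomogeneousComponent_mem_supported hq) hu ?_ ?_)
  · exact vars_nonempty_of_isWeightedHomogeneous hlead.1 hne (by positivity)
  · exact vars_nonempty_of_isWeightedHomogeneous h₁.1 hu0 (by positivity)

/-- The weight that `x` must have for `x^{m 0} y^{m 1}` to have weight `θ²`, if `x` has weight `θ`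
and `y` has weight `d`: the positive root of `θ² = (m 0) θ + (m 1) d`. -/
noncomputable def monomialRoot (d : ℕ) (m : Fin 3 →₀ ℕ) : ℝ := largerRoot (m 0) (-(m 1 * d))

theorem monomialRoot_mul_self (d : ℕ) (m : Fin 3 →₀ ℕ) :
    (m 0 * monomialRoot d m + m 1 * d : ℝ) = monomialRoot d m * monomialRoot d m := by
  have h := quadratic_largerRoot_eq_zero (b := m 0) (c := -(m 1 * d)) <| by
    have : (0 : ℝ) ≤ m 1 * d := by positivity
    nlinarith [sq_nonneg (m 0 : ℝ)]
  rw [monomialRoot]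
  linear_combination -h

theorem mul_add_mul_le_of_monomialRoot_le {m : Fin 3 →₀ ℕ} (h : monomialRoot d m ≤ θ) :
    (m 0 * θ + m 1 * d : ℝ) ≤ θ * θ := by
  linear_combination quadratic_nonneg_of_largerRoot_le h

theorem isNatQuadratic_monomialRoot (d : ℕ) (m : Fin 3 →₀ ℕ) :
    IsNatQuadratic (monomialRoot d m) :=
  ⟨m 0, m 1 * d, by push_cast; linear_combination -monomialRoot_mul_self d m⟩

theorem isNatQuadratic_of_hasSkewWeights (hd : 0 < d)
    (H : ∀ θ : ℝ, 1 < θ → HasSkewWeights p₀ p₁ p₂ d θ) (hq : q ∈ supported k {0, 1}) :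
    IsNatQuadratic (mk ![p₀ + q, p₁, p₂]).dynamicalDegree := by
  have upper : ∀ θ : ℝ, 1 < θ → (∀ m ∈ q.support, monomialRoot d m ≤ θ) →
      (mk ![p₀ + q, p₁, p₂]).dynamicalDegree ≤ θ := fun θ hθ hle =>
    (H θ hθ).dynamicalDegree_le hd (zero_lt_one.trans hθ) hq fun m hm =>
      mul_add_mul_le_of_monomialRoot_le (hle m hm)
  by_cases! hone : ∀ m ∈ q.support, monomialRoot d m ≤ 1
  · exact isNatQuadratic_of_dynamicalDegree_le_one <| le_of_forall_gt_imp_ge_of_dense fun θ hθ =>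
      upper θ hθ fun m hm => (hone m hm).trans hθ.le
  obtain ⟨m₀, hm₀, hlt⟩ := hone
  obtain ⟨m, hm, hmax⟩ := Finset.exists_max_image q.support (monomialRoot d) ⟨m₀, hm₀⟩
  have hθ : 1 < monomialRoot d m := hlt.trans_le (hmax m₀ hm₀)
  rw [(upper _ hθ hmax).antisymm <| (H _ hθ).le_dynamicalDegree hd (zero_lt_one.trans hθ) hq
    (fun m' hm' => mul_add_mul_le_of_monomialRoot_le (hmax m' hm')) hm (monomialRoot_mul_self d m)]
  exact isNatQuadratic_monomialRoot d m

end Skew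

end PolyEnd

namespace PolyEnd

variable {k : Type*} [Field k] {p q : MvPolynomial (Fin 3) k} {a b c e e' : k}

theorem isNatQuadratic_dynamicalDegree_xyz (hp : p ∈ supported k {0})
    (hq : q ∈ supported k {0, 1}) :
    IsNatQuadratic (mk ![C a * X 0 + C e, C b * X 1 + p, C c * X 2 + q]).dynamicalDegree := by
  have hB : (0 : ℝ) < degreeOf 0 p + 1 := by positivity
  have hC : (0 : ℝ) < degreeOf 0 q + degreeOf 1 q * (degreeOf 0 p + 1) + 1 := by positivity
  refine isNatQuadratic_of_dynamicalDegree_le_one <|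
    dynamicalDegree_le_of_mem_weightLE_three one_pos hB hC zero_le_one ?_ ?_ ?_
  all_goals rw [one_mul]
  · exact (hasLeadingForm_C_mul_X_add_C (i := 0) a e one_pos).mem_weightLE
  · refine add_mem (C_mul_X_mem_weightLE b le_rfl) ?_
    exact mem_weightLE_of_mem_supported_singleton hp zero_le_one
      ((mul_one _).trans_le (le_add_of_nonneg_right zero_le_one))
  · refine add_mem (C_mul_X_mem_weightLE c le_rfl) ?_
    refine mem_weightLE_of_mem_supported_pair hq zero_ne_one zero_le_one hB.le ?_
    exact (congrArg (· + _) (mul_one _)).trans_le (le_add_of_nonneg_right zero_le_one)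

theorem C_mul_X_mem_supported_singleton (a : k) (i : Fin 3) :
    (C a * X i : MvPolynomial (Fin 3) k) ∈ supported k {i} :=
  mul_mem (C_mem_supported a) (X_mem_supported.mpr rfl)

theorem C_mul_X_ne_zero (ha : a ≠ 0) (i : Fin 3) : (C a * X i : MvPolynomial (Fin 3) k) ≠ 0 :=
  mul_ne_zero (C_ne_zero.mpr ha) (X_ne_zero i)

theorem mem_vars_C_mul_X_add_C (ha : a ≠ 0) (e : k) (i : Fin 3) :
    i ∈ (C a * X i + C e).vars :=
  (mem_vars_iff_mem_support i).mpr
    ⟨Finsupp.single i 1, by simp [coeff_C, eq_comm (a := (0 : Fin 3 →₀ ℕ)), ha], by simp⟩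

theorem isNatQuadratic_dynamicalDegree_yxz (hp : p ∈ supported k {0})
    (hq : q ∈ supported k {0, 1}) (ha : a ≠ 0) :
    IsNatQuadratic (mk ![C b * X 1 + p, C a * X 0 + C e, C c * X 2 + q]).dynamicalDegree := by
  refine isNatQuadratic_of_hasSkewWeights one_pos (fun θ hθ => ?_) (supported_mono (by simp) hp)
  have hν : (0 : ℝ) < degreeOf 0 q + degreeOf 1 q + 1 := by positivity
  have hθ0 : 0 < θ := one_pos.trans hθ
  refine ⟨degreeOf 0 q + degreeOf 1 q + 1, hν, C_mul_X_mem_weightLT b ?_,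
    ⟨C a * X 0, C_mul_X_mem_supported_singleton a 0, C_mul_X_ne_zero ha 0, ?_⟩,
    add_mem (C_mul_X_mem_weightLE c ?_)
      (mem_weightLE_of_mem_supported_pair hq zero_ne_one hθ0.le (Nat.cast_nonneg 1) ?_)⟩
  · change ((1 : ℕ) : ℝ) < θ * θ
    rw [Nat.cast_one]
    nlinarith
  · rw [Nat.cast_one, mul_one]
    exact hasLeadingForm_C_mul_X_add_C a e hθ0
  · exact le_mul_of_one_le_left hν.le hθ.le
  · have : (0 : ℝ) ≤ degreeOf 1 q := Nat.cast_nonneg _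
    change degreeOf 0 q * θ + degreeOf 1 q * ((1 : ℕ) : ℝ) ≤ θ * _
    rw [Nat.cast_one]
    nlinarith

theorem isNatQuadratic_dynamicalDegree_zxy_const (hq : q ∈ supported k {0, 1}) (ha : a ≠ 0) :
    IsNatQuadratic (mk ![C c * X 2 + q, C a * X 0 + C e, C b * X 1 + C e']).dynamicalDegree := by
  refine isNatQuadratic_of_hasSkewWeights one_pos (fun θ hθ => ?_) hq
  have hθ0 : 0 < θ := one_pos.trans hθ
  refine ⟨θ⁻¹, inv_pos.mpr hθ0, C_mul_X_mem_weightLT c ?_,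
    ⟨C a * X 0, C_mul_X_mem_supported_singleton a 0, C_mul_X_ne_zero ha 0, ?_⟩, ?_⟩
  · exact (inv_lt_one_of_one_lt₀ hθ).trans (one_lt_mul hθ.le hθ)
  · rw [Nat.cast_one, mul_one]
    exact hasLeadingForm_C_mul_X_add_C a e hθ0
  · rw [mul_inv_cancel₀ hθ0.ne', Nat.cast_one]
    exact (hasLeadingForm_C_mul_X_add_C (i := 1) b e' one_pos).mem_weightLE

theorem dynamicalDegree_zyx_le {θ : ℝ} (hp : p ∈ supported k {1}) (hq : q ∈ supported k {0, 1})
    (hθ : 1 < θ) (hqθ : degreeOf 0 q < θ) :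
    (mk ![C c * X 2 + q, C b * X 1 + C e, C a * X 0 + p]).dynamicalDegree ≤ θ := by
  have hθ0 : 0 < θ := one_pos.trans hθ
  have hδ : 0 < θ * (θ - degreeOf 0 q) := mul_pos hθ0 (sub_pos.mpr hqθ)
  obtain ⟨N, hN, hNp, hNq⟩ : ∃ N : ℝ, 0 < N ∧ (degreeOf 1 p : ℝ) ≤ N ∧
      (degreeOf 1 q : ℝ) ≤ N * (θ * (θ - degreeOf 0 q)) := by
    refine ⟨1 + degreeOf 1 p + degreeOf 1 q / (θ * (θ - degreeOf 0 q)), by positivity, ?_, ?_⟩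
    · have : (0 : ℝ) ≤ degreeOf 1 q / (θ * (θ - degreeOf 0 q)) := by positivity
      linarith
    · rw [← div_le_iff₀ hδ]
      exact le_add_of_nonneg_left (by positivity)
  have hNθ : N ≤ θ * N := le_mul_of_one_le_left hN.le hθ.le
  refine dynamicalDegree_le_of_mem_weightLE_three (mul_pos hθ0 hN) one_pos hN hθ0.le
    (add_mem (C_mul_X_mem_weightLE c ?_) ?_) (weightLE_mono ?_
      (hasLeadingForm_C_mul_X_add_C (i := 1) b e one_pos).mem_weightLE)
    (add_mem (C_mul_X_mem_weightLE a le_rfl) ?_)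
  · exact hNθ.trans (le_mul_of_one_le_left (mul_pos hθ0 hN).le hθ.le)
  · refine mem_weightLE_of_mem_supported_pair hq zero_ne_one (mul_pos hθ0 hN).le zero_le_one ?_
    change degreeOf 0 q * (θ * N) + degreeOf 1 q * 1 ≤ θ * (θ * N)
    linarith
  · exact hθ.le.trans_eq (mul_one θ).symm
  · exact mem_weightLE_of_mem_supported_singleton hp zero_le_one
      ((mul_one _).trans_le (hNp.trans hNθ))

theorem degreeOf_le_dynamicalDegree_zyx (hp : p ∈ supported k {1}) (hq : q ∈ supported k {0, 1})
    (hb : b ≠ 0) (hd : 1 < degreeOf 0 q) :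
    (degreeOf 0 q : ℝ) ≤
      (mk ![C c * X 2 + q, C b * X 1 + C e, C a * X 0 + p]).dynamicalDegree := by
  obtain ⟨m, hm, hm0⟩ := exists_mem_support_eq_degreeOf
    (ne_zero_of_degreeOf_ne_zero (zero_lt_one.trans hd).ne') 0
  set d := (degreeOf 0 q : ℝ)
  have hd1 : 1 < d := Nat.one_lt_cast.mpr hd
  have hd0 : 0 < d := one_pos.trans hd1
  have hlead := hasLeadingForm_weightedHomogeneousComponent (μ := ![d, 0, 1]) (W := d * d) (p := q)
    (mem_weightLE_of_mem_supported_pair hq zero_ne_one hd0.le le_rfl (by simp [d]))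
  have hbe : C b * X 1 + C e ∈ supported k {(1 : Fin 3)} :=
    add_mem (C_mul_X_mem_supported_singleton b 1) (C_mem_supported e)
  have h₀ : HasLeadingForm ![d, 0, 1] (C c * X 2 + q) (d * d)
      (weightedHomogeneousComponent ![d, 0, 1] (d * d) q) := by
    rw [add_comm]
    exact hlead.add_mem_weightLT (C_mul_X_mem_weightLT c (one_lt_mul hd1.le hd1))
  have h₁ : HasLeadingForm ![d, 0, 1] (C b * X 1 + C e) (d * 0) (C b * X 1 + C e) := by
    rw [mul_zero]
    exact ((hasLeadingForm_X 1).C_mul b).add (hasLeadingForm_self (isWeightedHomogeneous_C _ e))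
  have h₂ : HasLeadingForm ![d, 0, 1] (C a * X 0 + p) (d * 1) (C a * X 0) := by
    rw [mul_one]
    refine ((hasLeadingForm_X 0).C_mul a).add_mem_weightLT (weightLE_le_weightLT hd0 ?_)
    exact mem_weightLE_of_mem_supported_singleton hp le_rfl (mul_zero _).le
  refine le_dynamicalDegree_of_hasLeadingForm_three hd0 hd0 h₀ h₁ h₂
    (pow_coord_ne_zero_of_mem_supported_pair (i' := 1) (j := 0) (j' := 1)
      (weightedHomogeneousComponent_mem_supported hq) (supported_mono (by simp) hbe)
      ((mem_vars_iff_mem_support 0).mpr ⟨m, mem_support_weightedHomogeneousComponent.mpr ⟨hm, ?_⟩,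
        Finsupp.mem_support_iff.mpr (by omega)⟩)
      (mem_vars_C_mul_X_add_C hb e 1)
      (supported_mono (by simp) hbe))
  rw [weight_three_of_mem_support hq hm, hm0, mul_zero, add_zero]

theorem isNatQuadratic_dynamicalDegree_zyx_fibered (hp : p ∈ supported k {1})
    (hq : q ∈ supported k {0, 1}) (hb : b ≠ 0) :
    IsNatQuadratic (mk ![C c * X 2 + q, C b * X 1 + C e, C a * X 0 + p]).dynamicalDegree := by
  rcases Nat.lt_or_ge 1 (degreeOf 0 q) with hd | hd
  · have hd1 : (1 : ℝ) < degreeOf 0 q := Nat.one_lt_cast.mpr hd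
    rw [(le_of_forall_gt_imp_ge_of_dense fun θ hθ =>
      dynamicalDegree_zyx_le hp hq (hd1.trans hθ) hθ).antisymm
      (degreeOf_le_dynamicalDegree_zyx hp hq hb hd)]
    exact isNatQuadratic_natCast _
  · exact isNatQuadratic_of_dynamicalDegree_le_one <| le_of_forall_gt_imp_ge_of_dense fun θ hθ =>
      dynamicalDegree_zyx_le hp hq hθ ((Nat.cast_le_one.mpr hd).trans_lt hθ)

theorem exists_eq_C_of_degreeOf_eq_zero {i : Fin 3} (hp : p ∈ supported k {i})
    (h : degreeOf i p = 0) : ∃ e, p = C e := by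
  have hp' : p ∈ supported k ∅ := mem_supported.mpr fun j hj => by
    obtain rfl : j = i := mem_supported.mp hp hj
    exact mem_vars_iff_degreeOf_ne_zero.mp hj h
  rw [supported_empty, Algebra.mem_bot] at hp'
  exact hp'.imp fun _ h => h.symm

theorem isNatQuadratic_dynamicalDegree_zyx (hp : p ∈ supported k {0})
    (hq : q ∈ supported k {0, 1}) (hb : b ≠ 0) :
    IsNatQuadratic (mk ![C c * X 2 + q, C b * X 1 + p, C a * X 0 + C e]).dynamicalDegree := by
  set d := degreeOf 0 p
  rcases Nat.eq_zero_or_pos d with hd | hd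
  · obtain ⟨e', rfl⟩ := exists_eq_C_of_degreeOf_eq_zero hp hd
    exact isNatQuadratic_dynamicalDegree_zyx_fibered (C_mem_supported e) hq hb
  obtain ⟨m, hm, hm0⟩ := exists_mem_support_eq_degreeOf (ne_zero_of_degreeOf_ne_zero hd.ne') 0
  refine isNatQuadratic_of_hasSkewWeights hd (fun θ hθ => ?_) hq
  have hθ0 : 0 < θ := one_pos.trans hθ
  have hlead := hasLeadingForm_weightedHomogeneousComponent (μ := ![θ, d, 1]) (W := θ * d) (p := p)
    (mem_weightLE_of_mem_supported_singleton hp hθ0.le (mul_comm _ _).le)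
  refine ⟨1, one_pos, C_mul_X_mem_weightLT c (one_lt_mul hθ.le hθ),
    ⟨weightedHomogeneousComponent ![θ, d, 1] (θ * d) p,
      weightedHomogeneousComponent_mem_supported hp, support_nonempty.mp
        ⟨m, mem_support_weightedHomogeneousComponent.mpr ⟨hm, ?_⟩⟩, ?_⟩, ?_⟩
  · have hp' : p ∈ supported k {0, 1} := supported_mono (by simp) hp
    have hm1 : m 1 = 0 := mem_support_notMem_vars_zero hm fun h => by
      simpa using mem_supported.mp hp h
    rw [weight_three_of_mem_support hp' hm, hm0, hm1, Nat.cast_zero, zero_mul, add_zero, mul_comm]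
  · rw [add_comm]
    exact hlead.add_mem_weightLT
      (C_mul_X_mem_weightLT b (lt_mul_of_one_lt_left (Nat.cast_pos.mpr hd) hθ))
  · rw [mul_one]
    exact (hasLeadingForm_C_mul_X_add_C (i := 0) a e hθ0).mem_weightLE

end PolyEnd

namespace PolyEnd

variable {k : Type*} [Field k]

theorem dynamicalDegree_eq_of_semiconj {n : ℕ} {f f' φ : PolyEnd k n} (hφ : IsUnit φ)
    (h : φ * f = f' * φ) : f.dynamicalDegree = f'.dynamicalDegree :=
  dynamicalDegree_eq_of_isConj ⟨hφ.unit, h⟩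

theorem isTriangularCoord_X {n : ℕ} (i : Fin n) :
    IsTriangularCoord i (X i : MvPolynomial (Fin n) k) :=
  ⟨1, one_ne_zero, 0, zero_mem _, by rw [C_1, one_mul, add_zero]⟩

theorem Iio_one_fin_three : Set.Iio (1 : Fin 3) = {0} := by
  ext i
  fin_cases i <;> simp

theorem Iio_two_fin_three : Set.Iio (2 : Fin 3) = {0, 1} := by
  ext i
  fin_cases i <;> simp

variable {p q : MvPolynomial (Fin 3) k} {a b c e : k}

/-- The exchange of the variables `x` and `y` in `k[x, y, z]`. -/
noncomputable def swapXY : MvPolynomial (Fin 3) k →ₐ[k] MvPolynomial (Fin 3) k :=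
  bind₁ ![X 1, X 0, X 2]

theorem dynamicalDegree_swapXY (p₀ p₁ p₂ : MvPolynomial (Fin 3) k) :
    (mk ![p₀, p₁, p₂]).dynamicalDegree =
      (mk ![swapXY p₁, swapXY p₀, swapXY p₂]).dynamicalDegree := by
  have hinv : (mk ![X 1, X 0, X 2] : PolyEnd k 3) * mk ![X 1, X 0, X 2] = 1 := by
    refine ext_three ?_ ?_ ?_ <;> simp [mul_coord, one_coord]
  have hswap (p : MvPolynomial (Fin 3) k) : bind₁ ![X 1, X 0, X 2] (swapXY p) = p := by
    rw [swapXY, bind₁_bind₁]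
    exact (congrArg (fun f => bind₁ (coord f) p) hinv).trans (aeval_X_left_apply p)
  refine dynamicalDegree_eq_of_semiconj (isUnit_of_mul_eq_one hinv hinv) ?_
  refine ext_three ?_ ?_ ?_ <;> simp [mul_coord, hswap]

theorem swapXY_mem_supported (hq : q ∈ supported k {0, 1}) : swapXY q ∈ supported k {0, 1} :=
  bind₁_mem_supported hq fun i hi => by
    rcases hi with rfl | rfl <;> simp [X_mem_supported]

theorem swapXY_mem_supported_one (hp : p ∈ supported k {0}) : swapXY p ∈ supported k {1} :=
  bind₁_mem_supported hp fun i hi => by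
    rw [Set.mem_singleton_iff.mp hi]
    exact X_mem_supported.mpr rfl

theorem isNatQuadratic_dynamicalDegree_xzy (hp : p ∈ supported k {0})
    (hq : q ∈ supported k {0, 1}) (ha : a ≠ 0) :
    IsNatQuadratic (mk ![C a * X 0 + C e, C c * X 2 + q, C b * X 1 + p]).dynamicalDegree := by
  have h := isNatQuadratic_dynamicalDegree_zyx_fibered (a := b) (c := c) (e := e)
    (swapXY_mem_supported_one hp) (swapXY_mem_supported hq) ha
  rw [dynamicalDegree_swapXY]
  simpa [swapXY] using h

theorem isNatQuadratic_dynamicalDegree_yzx_const (hq : q ∈ supported k {0, 1}) :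
    IsNatQuadratic (mk ![X 1, C c * X 2 + q, C a * X 0 + C e]).dynamicalDegree := by
  have h := isNatQuadratic_dynamicalDegree_zxy_const (a := 1) (b := a) (c := c) (e := 0) (e' := e)
    (swapXY_mem_supported hq) one_ne_zero
  rw [dynamicalDegree_swapXY]
  simpa [swapXY] using h

theorem isNatQuadratic_dynamicalDegree_yzx (hp : p ∈ supported k {0})
    (hq : q ∈ supported k {0, 1}) (hb : b ≠ 0) :
    IsNatQuadratic (mk ![C b * X 1 + p, C c * X 2 + q, C a * X 0 + C e]).dynamicalDegree := by
  have hT : ∀ i, IsTriangularCoord i ((mk ![X 0, C b * X 1 + p, X 2]).coord i) :=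
    forall_fin_three (isTriangularCoord_X 0) ⟨b, hb, p, Iio_one_fin_three ▸ hp, rfl⟩
      (isTriangularCoord_X 2)
  obtain ⟨T', hT', hinv⟩ := exists_mul_eq_one_of_isTriangularCoord hT
  have hqT : bind₁ (mk ![X 0, C b * X 1 + p, X 2]).coord (bind₁ T'.coord q) = q := by
    rw [bind₁_bind₁]
    exact (congrArg (fun f => bind₁ (coord f) q) hinv).trans (aeval_X_left_apply q)
  have hq' : C b * bind₁ T'.coord q + swapXY p ∈ supported k {0, 1} := by
    refine add_mem (mul_mem (C_mem_supported b) (bind₁_mem_supported hq fun i hi => ?_))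
      (supported_mono (by simp) (swapXY_mem_supported_one hp))
    have hi1 : i ≤ 1 := by rcases hi with rfl | rfl <;> decide
    rw [← Iio_two_fin_three]
    exact supported_mono (Set.Iic_subset_Iio.mpr (hi1.trans_lt (by decide))) (hT' i).mem_supported
  have hpT : bind₁ ![C b * X 1 + p, C c * X 2 + q, C a * X 0 + C e] p =
      bind₁ ![X 0, C b * X 1 + p, X 2] (swapXY p) := by
    rw [swapXY, bind₁_bind₁]
    refine algHom_eq_of_mem_supported hp fun i hi => ?_
    rw [Set.mem_singleton_iff.mp hi]
    simp
  rw [dynamicalDegree_eq_of_semiconj (isUnit_of_isTriangularCoord hT)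
    (f' := mk ![X 1, C (b * c) * X 2 + (C b * bind₁ T'.coord q + swapXY p), C a * X 0 + C e])]
  · exact isNatQuadratic_dynamicalDegree_yzx_const hq'
  · refine ext_three ?_ ?_ ?_
    · simp [mul_coord]
    · simp only [mul_coord, Matrix.cons_val_zero, Matrix.cons_val_one, Matrix.cons_val, map_add,
        map_mul, bind₁_C_right, bind₁_X_right, hpT, hqT]
      ring
    · simp [mul_coord]

theorem isNatQuadratic_dynamicalDegree_zxy (hp : p ∈ supported k {0})
    (hq : q ∈ supported k {0, 1}) (ha : a ≠ 0) :
    IsNatQuadratic (mk ![C c * X 2 + q, C a * X 0 + C e, C b * X 1 + p]).dynamicalDegree := by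
  let w : MvPolynomial (Fin 3) k := bind₁ (fun _ => C a⁻¹ * (X 1 - C e)) p
  have hw : w ∈ supported k {0, 1} := bind₁_mem_supported hp fun _ _ =>
    mul_mem (C_mem_supported _) (sub_mem (X_mem_supported.mpr (by simp)) (C_mem_supported _))
  have hφ : ∀ i, IsTriangularCoord i ((mk ![X 0, X 1, X 2 - w]).coord i) :=
    forall_fin_three (isTriangularCoord_X 0) (isTriangularCoord_X 1)
      ⟨1, one_ne_zero, -w, neg_mem (Iio_two_fin_three ▸ hw), by simp [sub_eq_add_neg]⟩
  have hfix : ∀ r ∈ supported k {0, 1}, bind₁ ![X 0, X 1, X 2 - w] r = r := fun r hr =>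
    bind₁_eq_self_of_mem_supported hr fun i hi => by
      rcases hi with rfl | rfl <;> rfl
  have hwf : bind₁ ![C c * X 2 + q, C a * X 0 + C e, C b * X 1 + p] w = p := by
    rw [bind₁_bind₁]
    refine bind₁_eq_self_of_mem_supported hp fun i hi => ?_
    rw [Set.mem_singleton_iff.mp hi]
    simp [← mul_assoc, ← C_mul, ha]
  rw [dynamicalDegree_eq_of_semiconj (isUnit_of_isTriangularCoord hφ)
    (f' := mk ![C c * X 2 + (C c * w + q), C a * X 0 + C e, C b * X 1 + C 0])]
  · exact isNatQuadratic_dynamicalDegree_zxy_const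
      (add_mem (mul_mem (C_mem_supported c) hw) hq) ha
  · refine ext_three ?_ ?_ ?_
    · simp only [mul_coord, Matrix.cons_val_zero, Matrix.cons_val, map_add, map_mul,
        bind₁_C_right, bind₁_X_right, hfix w hw, hfix q hq]
      ring
    · simp [mul_coord]
    · simp [mul_coord, hwf]

theorem IsTriangular.exists_eq_mk_three {τ : PolyEnd k 3} (hτ : τ.IsTriangular) (hu : IsUnit τ) :
    ∃ a ≠ 0, ∃ e, ∃ b ≠ 0, ∃ p ∈ supported k {0}, ∃ c, ∃ q ∈ supported k {0, 1},
      τ = mk ![C a * X 0 + C e, C b * X 1 + p, C c * X 2 + q] := by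
  obtain ⟨a, ha, r, hr, h₀⟩ := hτ.isTriangularCoord hu 0
  obtain ⟨b, hb, p, hp, h₁⟩ := hτ.isTriangularCoord hu 1
  obtain ⟨c, -, q, hq, h₂⟩ := hτ.isTriangularCoord hu 2
  rw [show Set.Iio (0 : Fin 3) = ∅ from Set.Iio_bot, supported_empty, Algebra.mem_bot] at hr
  obtain ⟨e, rfl⟩ := hr
  rw [Iio_one_fin_three] at hp
  rw [Iio_two_fin_three] at hq
  exact ⟨a, ha, e, b, hb, p, hp, c, q, hq, ext_three h₀ h₁ h₂⟩

theorem perm_mul_eq_mk_three (σ : Equiv.Perm (Fin 3)) (τ : PolyEnd k 3) :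
    perm k σ * τ = mk ![τ.coord (σ 0), τ.coord (σ 1), τ.coord (σ 2)] :=
  ext_three (perm_mul_coord σ τ 0) (perm_mul_coord σ τ 1) (perm_mul_coord σ τ 2)

theorem perm_fin_three_cases : ∀ σ : Equiv.Perm (Fin 3),
    ⇑σ = ![0, 1, 2] ∨ ⇑σ = ![1, 0, 2] ∨ ⇑σ = ![0, 2, 1] ∨ ⇑σ = ![2, 1, 0] ∨
      ⇑σ = ![1, 2, 0] ∨ ⇑σ = ![2, 0, 1] := by
  decide

theorem IsAffineTriangular.isNatQuadratic_dynamicalDegree {g : PolyEnd k 3}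
    (h : g.IsAffineTriangular) (hg : IsUnit g) : IsNatQuadratic g.dynamicalDegree := by
  obtain ⟨σ, τ, hu, hτ, hconj⟩ := h.exists_isConj_perm_mul hg
  obtain ⟨a, ha, e, b, hb, p, hp, c, q, hq, rfl⟩ := hτ.exists_eq_mk_three hu
  rw [dynamicalDegree_eq_of_isConj hconj, perm_mul_eq_mk_three]
  rcases perm_fin_three_cases σ with hσ | hσ | hσ | hσ | hσ | hσ <;> rw [hσ]
  exacts [isNatQuadratic_dynamicalDegree_xyz hp hq, isNatQuadratic_dynamicalDegree_yxz hp hq ha,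
    isNatQuadratic_dynamicalDegree_xzy hp hq ha, isNatQuadratic_dynamicalDegree_zyx hp hq hb,
    isNatQuadratic_dynamicalDegree_yzx hp hq hb, isNatQuadratic_dynamicalDegree_zxy hp hq ha]

end PolyEnd

theorem mainTheorem10 (k : Type*) [Field k] (r s t : ℕ)
    (hr : 1 ≤ r) (hs : 1 ≤ s) (ht : 1 ≤ t) :
    IsUnit (PolyEnd.rstMap k r s t) ∧
    Tendsto (PolyEnd.rstMap k r s t).degreeSeq atTop
      (𝓝 (PolyEnd.rstMap k r s t).dynamicalDegree) ∧
    IsGreatest {x : ℝ | x ^ 2 - ((r : ℝ) + s + t) * x + (r : ℝ) * s = 0}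
      (PolyEnd.rstMap k r s t).dynamicalDegree ∧
    (s : ℝ) + 1 < (PolyEnd.rstMap k r s t).dynamicalDegree ∧
    ((∀ m : ℤ, (PolyEnd.rstMap k r s t).dynamicalDegree ≠ (m : ℝ)) →
      (∀ g : PolyEnd k 3, IsUnit g → g.IsAffineTriangular →
        g.dynamicalDegree ≠ (PolyEnd.rstMap k r s t).dynamicalDegree) ∧
      ¬ ∃ g : PolyEnd k 3, IsUnit g ∧ g.IsAffineTriangular ∧
        IsConj (PolyEnd.rstMap k r s t) g) := by
  have hdegree := PolyEnd.dynamicalDegree_rstMap (k := k) (s := s) hr ht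
  have hgreatest := isGreatest_largerRoot (four_mul_mul_le_add_add_sq (r := r) (s := s) (t := t))
  rw [← hdegree] at hgreatest
  have hne (hint : ∀ m : ℤ, (PolyEnd.rstMap k r s t).dynamicalDegree ≠ m) (g : PolyEnd k 3)
      (hg : IsUnit g) (hgt : g.IsAffineTriangular) :
      g.dynamicalDegree ≠ (PolyEnd.rstMap k r s t).dynamicalDegree := fun heq => by
    have hquad := hgt.isNatQuadratic_dynamicalDegree hg
    rw [heq] at hquad
    obtain ⟨m, hm⟩ := hquad.exists_int_eq (b := r + s + t) (c := r * s) (by positivity)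
      (by exact_mod_cast hgreatest.1)
    exact hint m hm
  refine ⟨PolyEnd.isUnit_rstMap, PolyEnd.tendsto_degreeSeq _, hgreatest,
    (add_one_lt_largerRoot hr ht).trans_eq hdegree.symm, fun hint => ⟨hne hint, ?_⟩⟩
  rintro ⟨g, hg, hgt, hconj⟩
  exact hne hint g hg hgt (PolyEnd.dynamicalDegree_eq_of_isConj hconj).symm
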